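/- Let $S$ be a closed topological surface with a cellular decomposition $\Sigma=(V,E,F)$ in which every 2-cell is a polygon with at least one side (a 2-cell may lie on both sides of a 1-cell), and let $\Phi\in(0,\frac{\pi}{2})^{E}$ be a weight. Given radii $r\in(0,\frac{\pi}{2}]^{F}$, for every 1-cell $e$ take two disks in the unit sphere $\mathbb S^2$ with the radii of the 2-cells on the two sides of $e$, such that the bigon $B_e$ in which they intersect has interior angle $\Phi(e)$. The centers of the two disks and the two intersection points of their boundary circles are the corners of a spherical quadrilateral $Q(e)$. Gluing the $Q(e)$ along their sides according to $\Sigma$ gives a spherical conical metric on $S$ with a circle pattern (the disks) realizing $(\Sigma,\Phi)$. "Spherical conical metric" below means such a metric with its circle pattern, and "isometry" means an isometry isotopic to the identity of $S$ that takes one circle pattern to the other. The geodesic curvatures of the metric form the vector $k=(\cot r_f)_{f\in F}\in\mathbb R_{\ge 0}^{F}$. Its total geodesic curvature is $L=(L_f)_{f\in F}$, where $L_f$ is the sum of $k_f\,\ell$ over all sides of 1-cells on which $f$ lies (a 1-cell with $f$ on both sides is counted twice), $\ell$ being the length of the side of the bigon $B_e$ on the boundary circle of the corresponding disk. For $F'\subset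 F$ let $E_{F'}$ be the set of 1-cells contained in the boundary of some 2-cell of $F'$. For $I\subset F$ put $\mathbb R^F_I=\{k\in\mathbb R^F: k_f>0 \text{ for } f\in I,\ k_f=0 \text{ for } f\notin I\}$ and $$\mathcal L_I=\Big\{L\in\mathbb R^F_I : \sum_{f\in F'}L_f<2\sum_{e\in E_{F'}}\Phi(e)\ \text{ for all } \emptyset\ne F'\subset I\Big\},$$ and let $$\mathcal L_1=\mathcal L_F,\qquad \bar\partial\mathcal L=\bigcup_{\emptyset\ne I\subsetneq F}\mathcal L_I\cup\{0\},\qquad \mathcal L=\mathcal L_1\cup\bar\partial\mathcal L,\qquad \bar\partial\mathbb R^F_{\ge0}=\bigcup_{\emptyset\ne I\subsetneq F}\mathbb R^F_I\cup\{0\}.$$ Then for $\hat L\in\mathbb R^F$ there exists a spherical conical metric on $S$ with total geodesic curvature $\hat L$ if and only if $\hat L\in\mathcal L$, and it is unique up to isometry if it exists. Moreover, every $k\in\mathbb R^F_{\ge0}$ is the vector of geodesic curvatures of a spherical conical metric, unique up to isometry, and the map $\mathcal E$ that sends $k$ to the total geodesic curvature of this metric is a homeomorphism from $\mathbb R^F_{\ge0}$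 onto $\mathcal L$ that maps $\mathbb R^F_{>0}$ onto $\mathcal L_1$, $\bar\partial\mathbb R^F_{\ge0}$ onto $\bar\partial\mathcal L$, and $\mathbb R^F_I$ onto $\mathcal L_I$ for every $I\subset F$. -/

import Mathlib

open scoped ENNReal RealInnerProductSpace

noncomputable section

namespace CirclePattern

/-! ### Cellular decompositions of closed surfaces -/

/-- The flags of a cellular decomposition with set of 1-cells `E`: a flag `(e, b, h)` is a 1-cell `e`,
one of its two sides `b` and one of its two ends `h`. Each flag is a triangle of the barycentric
subdivision: its corners are the end `h` of `e`, an interior point of `e`, and the auxiliary point of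
the 2-cell that lies on the side `b` of `e`. -/
abbrev CellFlag (E : Type*) := E × Bool × Bool

/-- The neighbouring flag at the other end of the same side of the same 1-cell. -/
def CellFlag.swapEnd {E : Type*} (x : CellFlag E) : CellFlag E := (x.1, x.2.1, !x.2.2)

/-- The neighbouring flag across the 1-cell. -/
def CellFlag.swapSide {E : Type*} (x : CellFlag E) : CellFlag E := (x.1, !x.2.1, x.2.2)

/-- The combinatorial data of a cellular decomposition of a closed surface (orientable or not) with
1-cells `E` and 2-cells `F`. The map `turn` sends a flag to the other flag that has the same corner of
the same 2-cell, and the 2-cells are the cycles of flags under `swapEnd` and `turn`, so they are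
polygons with at least one side. A 2-cell may have one or two sides, and it may lie on both sides of
a 1-cell. The 0-cells are the cycles of flags under `swapSide` and `turn`. -/
structure FlagGluing (E F : Type*) where
  turn : CellFlag E → CellFlag E
  turn_turn : ∀ x, turn (turn x) = x
  turn_ne : ∀ x, turn x ≠ x
  face : CellFlag E → F
  face_surjective : Function.Surjective face
  face_eq_iff : ∀ x y, face x = face y ↔
    Relation.EqvGen (fun x y : CellFlag E => y = x.swapEnd ∨ y = turn x) x y

/-- A closed triangle in barycentric coordinates. Coordinate `0` belongs to the 0-cell, coordinate `1`
to the point on the 1-cell, coordinate `2` to the auxiliary point of the 2-cell. -/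
abbrev Triangle := stdSimplex ℝ (Fin 3)

variable {S E F : Type*}

namespace FlagGluing

/-- Two flag triangles that are neighbours are glued along their common side, which is the side on
which the coordinate of the corner that changes vanishes. -/
def glue (G : FlagGluing E F) (a b : Σ _ : CellFlag E, Triangle) : Prop :=
  a.2 = b.2 ∧
    ((a.2 0 = 0 ∧ b.1 = a.1.swapEnd) ∨
     (a.2 1 = 0 ∧ b.1 = G.turn a.1) ∨
     (a.2 2 = 0 ∧ b.1 = a.1.swapSide))

/-- The surface obtained by gluing the flag triangles, with the quotient topology. -/
abbrev Realization (G : FlagGluing E F) := Quot G.glue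

/-- The 2-cell on the side `b` of the 1-cell `e`. -/
def sideFace (G : FlagGluing E F) (e : E) (b : Bool) : F := G.face (e, b, false)

open scoped Classical in
/-- `E_{F'}`: the 1-cells contained in the boundary of some 2-cell of `F'`. -/
def edgesOf [Fintype E] (G : FlagGluing E F) (F' : Finset F) : Finset E :=
  Finset.univ.filter fun e => ∃ b, G.sideFace e b ∈ F'

end FlagGluing

/-- A cellular decomposition of the topological space `S` with 1-cells `E` and 2-cells `F`. -/
structure CellularDecomposition (S : Type*) [TopologicalSpace S] (E F : Type*)
    extends FlagGluing E F where
  homeo : toFlagGluing.Realization ≃ₜ S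

/-- The point of `S` with coordinates `p` in the triangle of the flag `x`. -/
def CellularDecomposition.point [TopologicalSpace S] (D : CellularDecomposition S E F)
    (x : CellFlag E) (p : Triangle) : S :=
  D.homeo (Quot.mk _ ⟨x, p⟩)

/-! ### Spherical geometry -/

/-- Euclidean 3-space; `𝕊²` is its unit sphere, whose geodesic distance is the angle. -/
abbrev E3 := EuclideanSpace ℝ (Fin 3)

/-- The open spherical disk with center `c` and radius `r`. -/
def sphDisk (c : E3) (r : ℝ) : Set E3 :=
  {x | ‖x‖ = 1 ∧ InnerProductGeometry.angle c x < r}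

/-- The spherical circle with center `c` and radius `r`. -/
def sphCircle (c : E3) (r : ℝ) : Set E3 :=
  {x | ‖x‖ = 1 ∧ InnerProductGeometry.angle c x = r}

/-- The angle at the point `p` of the unit sphere between the great circle arcs from `p` to `a` and
from `p` to `b`: the angle of the components of `a` and `b` tangent to the sphere at `p`. -/
def sphAngle (p a b : E3) : ℝ :=
  InnerProductGeometry.angle (a - ⟪p, a⟫ • p) (b - ⟪p, b⟫ • p)

/-! ### Spherical conical metrics with circle pattern -/

/-- A spherical conical metric on `S` with a circle pattern that realizes the decomposition `D` and the
weight `Φ`, given by the spherical quadrilaterals from which it is glued. To every 2-cell belongs a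
radius in `(0, π/2]`. To every 1-cell `e` belong two disks in the unit sphere with centers
`center e b` and with the radii of the 2-cells on the sides `b` of `e`. The boundary circles of these
disks meet in the two points `corner e h`, and the interior angle there of the bigon in which the
disks intersect, which is `π` minus the angle between the directions to the centers, is `Φ e`. The
quadrilateral of `e` has the corners `center e false`, `corner e false`, `center e true`,
`corner e true`. -/
structure SphericalConicalMetric [TopologicalSpace S] (D : CellularDecomposition S E F)
    (Φ : E → ℝ) where
  radius : F → ℝ
  radius_mem : ∀ f, radius f ∈ Set.Ioc 0 (Real.pi / 2)
  center : E → Bool → E3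
  corner : E → Bool → E3
  norm_center : ∀ e b, ‖center e b‖ = 1
  corner_mem : ∀ e b h, corner e h ∈ sphCircle (center e b) (radius (D.sideFace e b))
  corner_ne : ∀ e, corner e false ≠ corner e true
  angle_corner : ∀ e h,
    Real.pi - sphAngle (corner e h) (center e false) (center e true) = Φ e

namespace SphericalConicalMetric

variable [TopologicalSpace S] {D : CellularDecomposition S E F} {Φ : E → ℝ}

/-- The radius of the disk on the side `b` of `e`. -/
def sideRadius (μ : SphericalConicalMetric D Φ) (e : E) (b : Bool) : ℝ :=
  μ.radius (D.sideFace e b)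

/-- The geodesic curvature `cot r` of the circles of the pattern. -/
def geodesicCurvature (μ : SphericalConicalMetric D Φ) (f : F) : ℝ := Real.cot (μ.radius f)

/-- The side on `∂D_b` of the bigon `D_false ∩ D_true` of the 1-cell `e`. -/
def bigonSide (μ : SphericalConicalMetric D Φ) (e : E) (b : Bool) : Set E3 :=
  sphCircle (μ.center e b) (μ.sideRadius e b) ∩ sphDisk (μ.center e (!b)) (μ.sideRadius e (!b))

/-- The length of a side of the bigon of `e`. -/
def sideLength (μ : SphericalConicalMetric D Φ) (e : E) (b : Bool) : ℝ :=
  (MeasureTheory.Measure.hausdorffMeasure (1 : ℝ) (μ.bigonSide e b)).toReal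

open scoped Classical in
/-- The total geodesic curvature `L_f`: the sum, over all sides of 1-cells on which `f` lies, of
the geodesic curvature times the length of the corresponding side of the bigon. -/
def totalGeodesicCurvature [Fintype E] (μ : SphericalConicalMetric D Φ) (f : F) : ℝ :=
  ∑ s : E × Bool with D.sideFace s.1 s.2 = f, μ.geodesicCurvature f * μ.sideLength s.1 s.2

/-- The point in the middle of the bigon of `e`: it lies on the great circle arc between the two
centers, at distance `(d + r - r') / 2` from the first one, where `d` is the distance of the centers
and `r`, `r'` are the radii. -/
def edgePoint (μ : SphericalConicalMetric D Φ) (e : E) : E3 :=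
  let d := InnerProductGeometry.angle (μ.center e false) (μ.center e true)
  let a := (d + μ.sideRadius e false - μ.sideRadius e true) / 2
  (Real.sin d)⁻¹ • (Real.sin (d - a) • μ.center e false + Real.sin a • μ.center e true)

/-- The parametrization, by the triangle of a flag `(e, b, h)`, of the spherical triangle with corners
`corner e h`, `edgePoint e`, `center e b`. The four flags of `e` fill its quadrilateral. -/
def chart (μ : SphericalConicalMetric D Φ) (x : CellFlag E) (p : Triangle) : E3 :=
  let y := p 0 • μ.corner x.1 x.2.2 + p 1 • μ.edgePoint x.1 + p 2 • μ.center x.1 x.2.1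
  ‖y‖⁻¹ • y

/-- The spherical distance of two points of `S` within a common flag triangle (`∞` if there is
none). -/
def stepDist (μ : SphericalConicalMetric D Φ) (x y : S) : ℝ≥0∞ :=
  ⨅ (i : CellFlag E) (p : Triangle) (q : Triangle) (_ : D.point i p = x) (_ : D.point i q = y),
    ENNReal.ofReal (InnerProductGeometry.angle (μ.chart i p) (μ.chart i q))

/-- The distance function on `S` of the glued metric: the infimum of the lengths of chains of
geodesic segments in the triangles (`∞` between different components of `S`). -/
def gluedDist (μ : SphericalConicalMetric D Φ) (x y : S) : ℝ≥0∞ :=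
  ⨅ (n : ℕ) (c : Fin (n + 1) → S) (_ : c 0 = x) (_ : c (Fin.last n) = y),
    ∑ i : Fin n, μ.stepDist (c i.castSucc) (c i.succ)

/-- The disk of the circle pattern that belongs to the 2-cell `f`, as a subset of `S`. -/
def disk (μ : SphericalConicalMetric D Φ) (f : F) : Set S :=
  {x | ∃ (e : E) (b : Bool), D.sideFace e b = f ∧ ∃ (b' h : Bool) (p : Triangle),
    D.point (e, b', h) p = x ∧ μ.chart (e, b', h) p ∈ sphDisk (μ.center e b) (μ.radius f)}

end SphericalConicalMetric

/-- A self-homeomorphism is isotopic to the identity. -/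
def IsotopicToId [TopologicalSpace S] (g : S ≃ₜ S) : Prop :=
  ∃ H : C(unitInterval × S, S), (∀ x, H (0, x) = x) ∧ (∀ x, H (1, x) = g x) ∧
    ∀ t, IsHomeomorph fun x => H (t, x)

/-- Equivalence of spherical conical metrics with circle pattern: there is an isometry, isotopic to
the identity, that takes one circle pattern to the other. -/
def SphericalConicalMetric.Isometric [TopologicalSpace S] {D : CellularDecomposition S E F}
    {Φ : E → ℝ} (μ ν : SphericalConicalMetric D Φ) : Prop :=
  ∃ g : S ≃ₜ S, (∀ x y, ν.gluedDist (g x) (g y) = μ.gluedDist x y) ∧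
    (∀ f, g '' μ.disk f = ν.disk f) ∧ IsotopicToId g

/-! ### The sets of curvatures -/

/-- The set `ℝ^{|F|}_{i₁⋯iₘ}` for `I = {i₁, …, iₘ}`: the coordinates in `I` are positive, the others
vanish. -/
def orthantStratum (I : Finset F) : Set (F → ℝ) :=
  {k | (∀ f ∈ I, 0 < k f) ∧ ∀ f ∉ I, k f = 0}

/-- The boundary of the closed orthant, as the union of its strata. -/
def orthantBoundary [Fintype F] : Set (F → ℝ) :=
  (⋃ (I : Finset F) (_ : I.Nonempty) (_ : I ≠ Finset.univ), orthantStratum I) ∪ {0}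

/-- The set `𝓛₁`. -/
def L₁ [Fintype E] (G : FlagGluing E F) (Φ : E → ℝ) : Set (F → ℝ) :=
  {L | (∀ f, 0 < L f) ∧ ∀ F' : Finset F, F'.Nonempty →
    ∑ f ∈ F', L f < 2 * ∑ e ∈ G.edgesOf F', Φ e}

/-- The set `𝓛_{i₁⋯iₘ}` for `I = {i₁, …, iₘ}`. -/
def LStratum [Fintype E] (G : FlagGluing E F) (Φ : E → ℝ) (I : Finset F) : Set (F → ℝ) :=
  {L | L ∈ orthantStratum I ∧ ∀ F' : Finset F, F' ⊆ I → F'.Nonempty →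
    ∑ f ∈ F', L f < 2 * ∑ e ∈ G.edgesOf F', Φ e}

/-- The set `∂̄𝓛`. -/
def LBoundary [Fintype E] [Fintype F] (G : FlagGluing E F) (Φ : E → ℝ) : Set (F → ℝ) :=
  (⋃ (I : Finset F) (_ : I.Nonempty) (_ : I ≠ Finset.univ), LStratum G Φ I) ∪ {0}

/-- The set `𝓛 = 𝓛₁ ∪ ∂̄𝓛`. -/
def LSet [Fintype E] [Fintype F] (G : FlagGluing E F) (Φ : E → ℝ) : Set (F → ℝ) :=
  L₁ G Φ ∪ LBoundary G Φ

end CirclePattern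

end

open CirclePattern

/-
A lens with prescribed radii and interior angle is rigid up to isometry of the sphere, and in polar
coordinates around the center of one of its disks the length of its side on that disk is explicit.
Hence a metric is determined by its geodesic curvatures `k`, and its total geodesic curvatures are
an explicit function `T k`.

The coordinate `T k f` does not increase when other coordinates of `k` increase, and it increases
when `k` is multiplied by `t > 1`. If `T k = T k'` and `k ≠ k'`, this is contradicted at a
coordinate of maximal ratio of the two vectors, so `T` is injective.

The total curvature of a side of the lens of a 1-cell `e` is less than the angle that the side of a
Euclidean lens with the same ratio of curvatures subtends, and the angles of the two sides of a
Euclidean lens add up to `2 Φ(e)`. The difference vanishes in the limit of infinite curvature.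
Therefore the inequalities defining `𝓛` hold for `T k`, and they become equalities in the limit when
exactly the curvatures of the 2-cells in `F'` tend to infinity. So `k` stays bounded as long as
`T k ≤ L` with `L ∈ 𝓛`. By this compactness `T` is proper onto `𝓛`, and `∑ k f` has a maximizer
under the constraint `T k ≤ L`. It satisfies `T k = L`: if `T k f < L f`, then `k f` could be
increased, which does not increase the other coordinates of `T k`.
-/

noncomputable section

namespace CirclePattern

open Real Set Filter Topology

/-! ### The curvature of a side of a lens -/

/-- The inverse `ℝ → (0, π)` of the cotangent. -/
def arccot (z : ℝ) : ℝ := π / 2 - arctan z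

theorem arccot_mem_Ioo (z : ℝ) : arccot z ∈ Ioo 0 π := by
  constructor <;> rw [arccot] <;> linarith [arctan_lt_pi_div_two z, neg_pi_div_two_lt_arctan z]

theorem cos_arccot (z : ℝ) : cos (arccot z) = sin (arctan z) := cos_pi_div_two_sub _

theorem sin_arccot (z : ℝ) : sin (arccot z) = cos (arctan z) := sin_pi_div_two_sub _

theorem cot_arccot (z : ℝ) : cot (arccot z) = z := by
  rw [cot_eq_cos_div_sin, cos_arccot, sin_arccot, ← tan_eq_sin_div_cos, tan_arctan]

theorem arccot_strictAnti : StrictAnti arccot := fun _ _ h =>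
  sub_lt_sub_left (arctan_strictMono h) _

theorem continuous_arccot : Continuous arccot := continuous_const.sub continuous_arctan

theorem hasDerivAt_arccot (z : ℝ) : HasDerivAt arccot (-(1 / (1 + z ^ 2))) z :=
  (hasDerivAt_arctan z).const_sub _

theorem sin_arccot_mul (z : ℝ) : sin (arccot z) * z = cos (arccot z) := by
  rw [cos_arccot, sin_arccot, ← tan_mul_cos (cos_arctan_pos z).ne', tan_arctan, mul_comm]

theorem arccot_eq_of_sin_mul_eq {t z : ℝ} (ht : t ∈ Ioo 0 π) (h : sin t * z = cos t) :
    arccot z = t := by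
  have hmem : π / 2 - t ∈ Ioo (-(π / 2)) (π / 2) := ⟨by linarith [ht.2], by linarith [ht.1]⟩
  rw [arccot, arctan_eq_of_tan_eq (x := π / 2 - t) ?_ hmem, sub_sub_cancel]
  rw [tan_eq_sin_div_cos, sin_pi_div_two_sub, cos_pi_div_two_sub,
    div_eq_iff (sin_pos_of_mem_Ioo ht).ne', mul_comm, h]

theorem arccot_cot {t : ℝ} (ht : t ∈ Ioo 0 π) : arccot (cot t) = t :=
  arccot_eq_of_sin_mul_eq ht <| by
    rw [cot_eq_cos_div_sin, mul_div_cancel₀ _ (sin_pos_of_mem_Ioo ht).ne']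

theorem cos_arccot_strictMono : StrictMono fun z => cos (arccot z) := fun _ _ h =>
  strictAntiOn_cos (Ioo_subset_Icc_self (arccot_mem_Ioo _)) (Ioo_subset_Icc_self (arccot_mem_Ioo _))
    (arccot_strictAnti h)

theorem cos_arccot_pos {z : ℝ} (hz : 0 < z) : 0 < cos (arccot z) := by
  rw [← sin_arccot_mul]
  exact mul_pos (sin_pos_of_mem_Ioo (arccot_mem_Ioo z)) hz

theorem cos_arccot_lt_one (z : ℝ) : cos (arccot z) < 1 := by
  rw [← cos_zero]
  exact strictAntiOn_cos (left_mem_Icc.2 pi_pos.le) (Ioo_subset_Icc_self (arccot_mem_Ioo z))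
    (arccot_mem_Ioo z).1

theorem tendsto_cos_arccot_atTop : Tendsto (fun z => cos (arccot z)) atTop (𝓝 1) := by
  have h : Tendsto arctan atTop (𝓝 (π / 2)) :=
    tendsto_nhds_of_tendsto_nhdsWithin tendsto_arctan_atTop
  simpa only [cos_arccot, Function.comp_def, sin_pi_div_two] using (continuous_sin.tendsto _).comp h

theorem hasDerivAt_mul_arccot_mul (c s : ℝ) :
    HasDerivAt (fun s => s * arccot (c * s)) (arccot (c * s) - c * s / (1 + (c * s) ^ 2)) s := by
  have h := (hasDerivAt_id s).mul
    ((hasDerivAt_arccot (c * s)).comp s ((hasDerivAt_id s).const_mul c))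
  refine h.congr_deriv ?_
  simp only [id, Function.comp_apply]
  ring

theorem div_one_add_sq_lt_arccot (z : ℝ) : z / (1 + z ^ 2) < arccot z := by
  have h : z / (1 + z ^ 2) = sin (2 * arccot z) / 2 := by
    rw [sin_two_mul, ← sin_arccot_mul, sin_arccot, div_eq_mul_one_div, ← cos_sq_arctan]
    ring
  linarith [sin_lt (mul_pos two_pos (arccot_mem_Ioo z).1)]

theorem mul_arccot_mul_strictMono (c : ℝ) : StrictMono fun s => s * arccot (c * s) :=
  strictMono_of_hasDerivAt_pos (hasDerivAt_mul_arccot_mul c) fun s =>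
    sub_pos.2 (div_one_add_sq_lt_arccot (c * s))

theorem abs_mul_arccot_mul_sub_le (c s t : ℝ) :
    |t * arccot (c * t) - s * arccot (c * s)| ≤ (π + 1) * |t - s| := by
  refine convex_univ.norm_image_sub_le_of_norm_hasDerivWithin_le (f := fun s => s * arccot (c * s))
    (fun x _ => (hasDerivAt_mul_arccot_mul c x).hasDerivWithinAt) (fun x _ => ?_)
    (mem_univ s) (mem_univ t)
  have h : -1 ≤ c * x / (1 + (c * x) ^ 2) := by
    rw [le_div_iff₀ (by positivity)]
    nlinarith [sq_nonneg (c * x + 1)]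
  rw [norm_of_nonneg (sub_pos.2 (div_one_add_sq_lt_arccot _)).le]
  linarith [(arccot_mem_Ioo (c * x)).2]

/-- Two circles of geodesic curvatures `x` and `y` on the unit sphere bound a lens with interior
angle `φ`; seen from the center of the circle of curvature `x`, its side on that circle subtends
twice this angle. -/
def halfAngle (φ x y : ℝ) : ℝ := arccot ((y + x * cos φ) * sin (arccot x) / sin φ)

theorem halfAngle_mem_Ioo (φ x y : ℝ) : halfAngle φ x y ∈ Ioo 0 π := arccot_mem_Ioo _

/-- The total geodesic curvature of the side on the circle of curvature `x` of a lens with angle `φ`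
between circles of curvatures `x` and `y`. The circle of curvature `x = cot r` has length
`2 * π * sin r`, whence the factor `cot r * sin r = cos r`. -/
def sideCurvature (φ x y : ℝ) : ℝ := 2 * (cos (arccot x) * halfAngle φ x y)

/-- The Euclidean counterpart of `halfAngle`, which depends only on the ratio `u = y / x` of the
curvatures. -/
def euclHalfAngle (φ u : ℝ) : ℝ := arccot ((u + cos φ) / sin φ)

theorem continuous_sideCurvature (φ : ℝ) {X : Type*} [TopologicalSpace X] {x y : X → ℝ}
    (hx : Continuous x) (hy : Continuous y) : Continuous fun p => sideCurvature φ (x p) (y p) := by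
  have h := continuous_arccot
  unfold sideCurvature halfAngle
  fun_prop

theorem sideCurvature_zero_left (φ y : ℝ) : sideCurvature φ 0 y = 0 := by
  rw [sideCurvature, ← sin_arccot_mul, mul_zero, zero_mul, mul_zero]

theorem sideCurvature_pos (φ : ℝ) {x : ℝ} (hx : 0 < x) (y : ℝ) : 0 < sideCurvature φ x y :=
  mul_pos two_pos (mul_pos (cos_arccot_pos hx) (halfAngle_mem_Ioo _ _ _).1)

theorem sideCurvature_nonneg (φ : ℝ) {x : ℝ} (hx : 0 ≤ x) (y : ℝ) : 0 ≤ sideCurvature φ x y := by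
  rcases hx.eq_or_lt with rfl | hx
  · exact (sideCurvature_zero_left φ y).ge
  · exact (sideCurvature_pos φ hx y).le

theorem sideCurvature_eq (φ : ℝ) {x : ℝ} (hx : x ≠ 0) (y : ℝ) : sideCurvature φ x y =
    2 * (cos (arccot x) * arccot ((y / x + cos φ) / sin φ * cos (arccot x))) := by
  rw [sideCurvature, halfAngle, ← sin_arccot_mul]
  congr 3
  field_simp

theorem sideCurvature_lt_two_mul_euclHalfAngle (φ : ℝ) {x : ℝ} (hx : x ≠ 0) (y : ℝ) :
    sideCurvature φ x y < 2 * euclHalfAngle φ (y / x) := by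
  have h := mul_arccot_mul_strictMono ((y / x + cos φ) / sin φ) (cos_arccot_lt_one x)
  rw [sideCurvature_eq φ hx, euclHalfAngle]
  simp only [one_mul, mul_one] at h
  linarith

theorem sideCurvature_lt_sideCurvature_mul (φ : ℝ) {x t : ℝ} (hx : 0 < x) (y : ℝ) (ht : 1 < t) :
    sideCurvature φ x y < sideCurvature φ (t * x) (t * y) := by
  have ht0 : 0 < t := one_pos.trans ht
  rw [sideCurvature_eq φ hx.ne', sideCurvature_eq φ (mul_pos ht0 hx).ne',
    mul_div_mul_left _ _ ht0.ne', mul_lt_mul_iff_right₀ two_pos]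
  exact mul_arccot_mul_strictMono _ (cos_arccot_strictMono ((lt_mul_iff_one_lt_left hx).2 ht))

theorem tendsto_sideCurvature_sub_two_mul_euclHalfAngle (φ : ℝ) {α : Type*} {l : Filter α}
    {x : α → ℝ} (hx : Tendsto x l atTop) (y : α → ℝ) :
    Tendsto (fun n => sideCurvature φ (x n) (y n) - 2 * euclHalfAngle φ (y n / x n)) l (𝓝 0) := by
  have h1 : Tendsto (fun n => 2 * ((π + 1) * |cos (arccot (x n)) - 1|)) l (𝓝 0) := by
    simpa using (((tendsto_cos_arccot_atTop.comp hx).sub_const 1).abs.const_mul (π + 1)).const_mul 2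
  refine squeeze_zero_norm' ?_ h1
  filter_upwards [hx.eventually_ne_atTop 0] with n hn
  have h := abs_mul_arccot_mul_sub_le ((y n / x n + cos φ) / sin φ) 1 (cos (arccot (x n)))
  rw [one_mul, mul_one] at h
  rw [sideCurvature_eq φ hn, ← mul_sub, norm_mul, norm_of_nonneg zero_le_two, euclHalfAngle]
  gcongr
  exact h

theorem sideCurvature_antitone {φ x : ℝ} (hφ : φ ∈ Ioo 0 π) (hx : 0 ≤ x) :
    Antitone (sideCurvature φ x) := fun y y' h => by
  have hs := sin_pos_of_mem_Ioo hφ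
  have hs' := sin_pos_of_mem_Ioo (arccot_mem_Ioo x)
  have hc : 0 ≤ cos (arccot x) := by
    rw [← sin_arccot_mul]
    exact mul_nonneg hs'.le hx
  unfold sideCurvature halfAngle
  gcongr
  exact arccot_strictAnti.antitone (by gcongr)

theorem euclHalfAngle_zero {φ : ℝ} (hφ : φ ∈ Ioo 0 π) : euclHalfAngle φ 0 = φ := by
  rw [euclHalfAngle, zero_add, ← cot_eq_cos_div_sin, arccot_cot hφ]

theorem euclHalfAngle_antitone {φ : ℝ} (hφ : φ ∈ Ioo 0 π) : Antitone (euclHalfAngle φ) :=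
  fun u u' h => by
    have hs := sin_pos_of_mem_Ioo hφ
    exact arccot_strictAnti.antitone (by gcongr)

theorem euclHalfAngle_add_inv {φ u : ℝ} (hφ : φ ∈ Ioo 0 π) (hu : 0 < u) :
    euclHalfAngle φ u + euclHalfAngle φ u⁻¹ = φ := by
  have hs := sin_pos_of_mem_Ioo hφ
  set β := euclHalfAngle φ u⁻¹
  have hβ : β ∈ Ioo 0 π := arccot_mem_Ioo _
  have hcos : cos β * sin φ = sin β * (u⁻¹ + cos φ) := by
    have h := sin_arccot_mul ((u⁻¹ + cos φ) / sin φ)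
    rw [← mul_div_assoc, div_eq_iff hs.ne'] at h
    exact h.symm
  have hsin : sin (φ - β) = u⁻¹ * sin β := by
    rw [sin_sub]
    linear_combination hcos
  have hmem : φ - β ∈ Ioo 0 π := by
    refine ⟨lt_of_not_ge fun h => ?_, by linarith [hφ.2, hβ.1]⟩
    have h1 := sin_nonpos_of_nonpos_of_neg_pi_le h (by linarith [hφ.1, hβ.2])
    exact h1.not_gt (hsin ▸ mul_pos (inv_pos.2 hu) (sin_pos_of_mem_Ioo hβ))
  rw [euclHalfAngle, arccot_eq_of_sin_mul_eq hmem, sub_add_cancel]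
  rw [hsin, cos_sub, ← mul_div_assoc, div_eq_iff hs.ne']
  linear_combination -cos φ * hcos + sin β * mul_inv_cancel₀ hu.ne' - sin β * sin_sq_add_cos_sq φ

theorem sideCurvature_lt {φ x y : ℝ} (hφ : φ ∈ Ioo 0 π) (hx : 0 ≤ x) (hy : 0 ≤ y) :
    sideCurvature φ x y < 2 * φ := by
  rcases hx.eq_or_lt with rfl | hx
  · rw [sideCurvature_zero_left]
    exact mul_pos two_pos hφ.1
  · have h := euclHalfAngle_antitone hφ (div_nonneg hy hx.le)
    rw [euclHalfAngle_zero hφ] at h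
    linarith [sideCurvature_lt_two_mul_euclHalfAngle φ hx.ne' y]

theorem sideCurvature_add_lt {φ x y : ℝ} (hφ : φ ∈ Ioo 0 π) (hx : 0 ≤ x) (hy : 0 ≤ y) :
    sideCurvature φ x y + sideCurvature φ y x < 2 * φ := by
  rcases hx.eq_or_lt with rfl | hx
  · rw [sideCurvature_zero_left, zero_add]
    exact sideCurvature_lt hφ hy le_rfl
  rcases hy.eq_or_lt with rfl | hy
  · rw [sideCurvature_zero_left, add_zero]
    exact sideCurvature_lt hφ hx.le le_rfl
  have h := euclHalfAngle_add_inv hφ (div_pos hy hx)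
  rw [inv_div] at h
  linarith [sideCurvature_lt_two_mul_euclHalfAngle φ hx.ne' y,
    sideCurvature_lt_two_mul_euclHalfAngle φ hy.ne' x]

section

variable {φ : ℝ} {α : Type*} {l : Filter α} {x y : α → ℝ}

theorem tendsto_sideCurvature (hφ : φ ∈ Ioo 0 π) (hx : Tendsto x l atTop) {M : ℝ}
    (hy0 : ∀ᶠ n in l, 0 ≤ y n) (hyM : ∀ᶠ n in l, y n ≤ M) :
    Tendsto (fun n => sideCurvature φ (x n) (y n)) l (𝓝 (2 * φ)) := by
  have hyx : Tendsto (fun n => y n / x n) l (𝓝 0) := tendsto_bdd_div_atTop_nhds_zero hy0 hyM hx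
  have hcont : Continuous (euclHalfAngle φ) := by
    have h := continuous_arccot
    unfold euclHalfAngle
    fun_prop
  have h := (tendsto_sideCurvature_sub_two_mul_euclHalfAngle φ hx y).add
    (((hcont.tendsto 0).comp hyx).const_mul 2)
  simpa only [Function.comp_def, sub_add_cancel, euclHalfAngle_zero hφ, zero_add] using h

theorem tendsto_sideCurvature_add (hφ : φ ∈ Ioo 0 π) (hx : Tendsto x l atTop)
    (hy : Tendsto y l atTop) :
    Tendsto (fun n => sideCurvature φ (x n) (y n) + sideCurvature φ (y n) (x n)) l
      (𝓝 (2 * φ)) := by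
  have h := ((tendsto_sideCurvature_sub_two_mul_euclHalfAngle φ hx y).add
    (tendsto_sideCurvature_sub_two_mul_euclHalfAngle φ hy x)).add_const (2 * φ)
  rw [add_zero, zero_add] at h
  refine h.congr' ?_
  filter_upwards [hx.eventually_gt_atTop 0, hy.eventually_gt_atTop 0] with n hxn hyn
  have h := euclHalfAngle_add_inv hφ (div_pos hyn hxn)
  rw [inv_div] at h
  linarith

end

/-! ### Off-diagonally antitone maps -/

section

variable {ι : Type*} {T : (ι → ℝ) → ι → ℝ}

/-- On the nonnegative orthant, increasing the coordinates other than `i` does not increase the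
`i`-th component of `T`. -/
def IsOffDiagAntitone (T : (ι → ℝ) → ι → ℝ) : Prop :=
  ∀ ⦃k k' : ι → ℝ⦄, 0 ≤ k → k ≤ k' → ∀ i, k i = k' i → T k' i ≤ T k i

theorem IsOffDiagAntitone.le_of_apply_le [Finite ι] (hT : IsOffDiagAntitone T)
    (hscale : ∀ ⦃k : ι → ℝ⦄ ⦃i : ι⦄ ⦃t : ℝ⦄, 0 < k i → 1 < t → T k i < T (t • k) i)
    {k k' : ι → ℝ} (hk : 0 ≤ k) (hk' : 0 ≤ k') (hsupp : ∀ i, 0 < k' i → 0 < k i)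
    (h : T k' ≤ T k) : k' ≤ k := by
  by_contra hle
  obtain ⟨i, hi⟩ : ∃ i, k i < k' i := by simpa [Pi.le_def] using hle
  have hki : 0 < k i := hsupp i ((hk i).trans_lt hi)
  have : Nonempty ι := ⟨i⟩
  -- At a coordinate `j` of maximal ratio `t = k' j / k j > 1` the vector `t • k` touches `k'`.
  obtain ⟨j, hj⟩ := Finite.exists_max fun i => k' i / k i
  set t := k' j / k j
  have ht : 1 < t := ((one_lt_div hki).2 hi).trans_le (hj i)
  have hkj : 0 < k j := (hk j).lt_of_ne' fun h0 => by
    rw [show t = 0 by simp [t, h0]] at ht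
    exact ht.not_ge zero_le_one
  have htk : k' ≤ t • k := fun m => by
    rcases (hk' m).eq_or_lt with h0 | hm
    · exact h0.symm.trans_le (mul_nonneg (zero_le_one.trans ht.le) (hk m))
    · exact (div_le_iff₀ (hsupp m hm)).1 (hj m)
  have htj : k' j = (t • k) j := (div_mul_cancel₀ _ hkj.ne').symm
  exact (((hT hk' htk j htj).trans (h j)).trans_lt (hscale hkj ht)).false

theorem IsOffDiagAntitone.exists_apply_eq [Finite ι] (hT : IsOffDiagAntitone T)
    (hcont : Continuous T) {L : ι → ℝ} (h0 : T 0 ≤ L)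
    (hcomp : IsCompact {k | 0 ≤ k ∧ T k ≤ L}) : ∃ k, 0 ≤ k ∧ T k = L := by
  classical
  have := Fintype.ofFinite ι
  have hsum : Continuous fun k : ι → ℝ => ∑ i, k i := by fun_prop
  obtain ⟨k, ⟨hk, hkL⟩, hmax⟩ := hcomp.exists_isMaxOn ⟨0, le_rfl, h0⟩ hsum.continuousOn
  refine ⟨k, hk, le_antisymm hkL fun i => ?_⟩
  by_contra! hi
  have hline : Continuous fun x => T (Function.update k i x) i := by fun_prop
  have hlt : ∀ᶠ x in 𝓝[>] k i, T (Function.update k i x) i < L i := by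
    refine (hline.tendsto (k i)).mono_left nhdsWithin_le_nhds |>.eventually_lt_const ?_
    rwa [Function.update_eq_self]
  obtain ⟨x, hxL, hx : k i < x⟩ := (hlt.and self_mem_nhdsWithin).exists
  have hle : k ≤ Function.update k i x := by simpa using hx.le
  have hmem : Function.update k i x ∈ {k | 0 ≤ k ∧ T k ≤ L} := by
    refine ⟨hk.trans hle, fun j => ?_⟩
    rcases eq_or_ne j i with rfl | hj
    · exact hxL.le
    · exact (hT hk hle j (Function.update_of_ne hj _ _).symm).trans (hkL j)
  refine (hmax hmem).not_gt (Finset.sum_lt_sum (fun j _ => hle j) ⟨i, Finset.mem_univ i, ?_⟩)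
  rwa [Function.update_self]

end

/-! ### The curvature map -/

section

variable {E F : Type*}

open scoped Classical in
/-- The total geodesic curvatures as functions of the geodesic curvatures. -/
def curvatureMap [Fintype E] (G : FlagGluing E F) (Φ : E → ℝ) (k : F → ℝ) (f : F) : ℝ :=
  ∑ s : E × Bool with G.sideFace s.1 s.2 = f,
    sideCurvature (Φ s.1) (k f) (k (G.sideFace s.1 (!s.2)))

open scoped Classical in
/-- The contribution of the 1-cell `e` to the sum of the total geodesic curvatures of the 2-cells
in `F'`. -/
def edgeCurvature (G : FlagGluing E F) (Φ : E → ℝ) (k : F → ℝ) (F' : Finset F) (e : E) : ℝ :=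
  ∑ b : Bool, if G.sideFace e b ∈ F' then
    sideCurvature (Φ e) (k (G.sideFace e b)) (k (G.sideFace e (!b))) else 0

/-- The inequalities that define the sets `𝓛_I`, for all nonempty sets of 2-cells. -/
def IsAdmissible [Fintype E] (G : FlagGluing E F) (Φ : E → ℝ) (L : F → ℝ) : Prop :=
  ∀ F' : Finset F, F'.Nonempty → ∑ f ∈ F', L f < 2 * ∑ e ∈ G.edgesOf F', Φ e

namespace FlagGluing

variable (G : FlagGluing E F)

theorem mem_edgesOf [Fintype E] {F' : Finset F} {e : E} :
    e ∈ G.edgesOf F' ↔ ∃ b, G.sideFace e b ∈ F' := by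
  simp [edgesOf]

theorem edgesOf_mono [Fintype E] : Monotone G.edgesOf := fun F₁ F₂ h e he => by
  rw [mem_edgesOf] at he ⊢
  exact he.imp fun b hb => h hb

theorem exists_sideFace_eq (f : F) : ∃ e b, G.sideFace e b = f := by
  obtain ⟨⟨e, b, h⟩, rfl⟩ := G.face_surjective f
  refine ⟨e, b, ?_⟩
  cases h
  · rfl
  · exact (G.face_eq_iff _ _).2 (.rel _ _ (Or.inl rfl))

theorem edgesOf_nonempty [Fintype E] {F' : Finset F} (h : F'.Nonempty) :
    (G.edgesOf F').Nonempty := by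
  obtain ⟨f, hf⟩ := h
  obtain ⟨e, b, rfl⟩ := G.exists_sideFace_eq f
  exact ⟨e, G.mem_edgesOf.2 ⟨b, hf⟩⟩

end FlagGluing

theorem sum_curvatureMap [Fintype E] (G : FlagGluing E F) (Φ : E → ℝ) (k : F → ℝ)
    (F' : Finset F) :
    ∑ f ∈ F', curvatureMap G Φ k f = ∑ e ∈ G.edgesOf F', edgeCurvature G Φ k F' e := by
  classical
  have hsupp : ∑ e ∈ G.edgesOf F', edgeCurvature G Φ k F' e = ∑ e, edgeCurvature G Φ k F' e := by
    refine Finset.sum_subset (Finset.subset_univ _) fun e _ he => ?_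
    rw [G.mem_edgesOf, not_exists] at he
    exact Finset.sum_eq_zero fun b _ => if_neg (he b)
  unfold edgeCurvature at hsupp ⊢
  rw [hsupp, ← Fintype.sum_prod_type' fun (e : E) (b : Bool) => if G.sideFace e b ∈ F' then
    sideCurvature (Φ e) (k (G.sideFace e b)) (k (G.sideFace e (!b))) else 0]
  simp_rw [curvatureMap, Finset.sum_filter]
  rw [Finset.sum_comm]
  exact Finset.sum_congr rfl fun s _ => Finset.sum_ite_eq F' (G.sideFace s.1 s.2)
    fun f => sideCurvature (Φ s.1) (k f) (k (G.sideFace s.1 (!s.2)))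

variable (G : FlagGluing E F) {Φ : E → ℝ} {k : F → ℝ}

theorem edgeCurvature_lt {e : E} (hΦ : Φ e ∈ Ioo 0 π) (hk : 0 ≤ k) (F' : Finset F) :
    edgeCurvature G Φ k F' e < 2 * Φ e := by
  rw [edgeCurvature, Fintype.sum_bool]
  simp only [Bool.not_true, Bool.not_false]
  split_ifs
  · exact sideCurvature_add_lt hΦ (hk _) (hk _)
  · rw [add_zero]
    exact sideCurvature_lt hΦ (hk _) (hk _)
  · rw [zero_add]
    exact sideCurvature_lt hΦ (hk _) (hk _)
  · rw [add_zero]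
    exact mul_pos two_pos hΦ.1

theorem tendsto_edgeCurvature {α : Type*} {l : Filter α} {κ : α → F → ℝ} (hκ : ∀ᶠ n in l, 0 ≤ κ n)
    {F' : Finset F} (htop : ∀ f ∈ F', Tendsto (κ · f) l atTop)
    (hbdd : ∀ f ∉ F', ∃ M, ∀ᶠ n in l, κ n f ≤ M) {e : E} (hΦ : Φ e ∈ Ioo 0 π)
    (he : ∃ b, G.sideFace e b ∈ F') :
    Tendsto (fun n => edgeCurvature G Φ (κ n) F' e) l (𝓝 (2 * Φ e)) := by
  have hone : ∀ f ∈ F', ∀ g ∉ F',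
      Tendsto (fun n => sideCurvature (Φ e) (κ n f) (κ n g)) l (𝓝 (2 * Φ e)) := fun f hf g hg => by
    obtain ⟨M, hM⟩ := hbdd g hg
    exact tendsto_sideCurvature hΦ (htop f hf) (hκ.mono fun n hn => hn g) hM
  simp only [edgeCurvature, Fintype.sum_bool, Bool.not_true, Bool.not_false]
  rw [Bool.exists_bool] at he
  by_cases h1 : G.sideFace e true ∈ F' <;> by_cases h0 : G.sideFace e false ∈ F'
  · simpa only [h1, h0, if_true] using tendsto_sideCurvature_add hΦ (htop _ h1) (htop _ h0)
  · simpa only [h1, h0, if_true, if_false, add_zero] using hone _ h1 _ h0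
  · simpa only [h1, h0, if_true, if_false, zero_add] using hone _ h0 _ h1
  · exact absurd he (not_or_intro h0 h1)

theorem tendsto_atTop_or_eventually_le {α : Type*} (U : Ultrafilter α) (x : α → ℝ) :
    Tendsto x U atTop ∨ ∃ M, ∀ᶠ n in U, x n ≤ M := by
  refine or_iff_not_imp_left.2 fun h => ?_
  rw [tendsto_atTop, not_forall] at h
  obtain ⟨M, hM⟩ := h
  exact ⟨M, (Ultrafilter.eventually_not.2 hM).mono fun n hn => (not_le.1 hn).le⟩

variable [Fintype E]

theorem curvatureMap_nonneg (hk : 0 ≤ k) : 0 ≤ curvatureMap G Φ k :=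
  fun f => Finset.sum_nonneg fun _ _ => sideCurvature_nonneg _ (hk f) _

open scoped Classical in
theorem sides_nonempty (f : F) :
    (Finset.univ.filter fun s : E × Bool => G.sideFace s.1 s.2 = f).Nonempty := by
  obtain ⟨e, b, rfl⟩ := G.exists_sideFace_eq f
  exact ⟨(e, b), by simp⟩

theorem curvatureMap_pos_iff {f : F} (hk : 0 ≤ k f) : 0 < curvatureMap G Φ k f ↔ 0 < k f := by
  refine ⟨fun h => hk.lt_of_ne' fun h0 => h.ne' ?_,
    fun h => Finset.sum_pos (fun _ _ => sideCurvature_pos _ h _) (sides_nonempty G f)⟩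
  exact Finset.sum_eq_zero fun s _ => by rw [h0, sideCurvature_zero_left]

theorem curvatureMap_lt_curvatureMap_smul {f : F} {t : ℝ} (hf : 0 < k f) (ht : 1 < t) :
    curvatureMap G Φ k f < curvatureMap G Φ (t • k) f :=
  Finset.sum_lt_sum_of_nonempty (sides_nonempty G f) fun _ _ =>
    sideCurvature_lt_sideCurvature_mul _ hf _ ht

theorem continuous_curvatureMap : Continuous (curvatureMap G Φ) := by
  refine continuous_pi fun f => ?_
  unfold curvatureMap
  exact continuous_finsetSum _ fun s _ =>
    continuous_sideCurvature (Φ s.1) (continuous_apply _) (continuous_apply _)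

variable (hΦ : ∀ e, Φ e ∈ Ioo 0 π)
include hΦ

theorem isOffDiagAntitone_curvatureMap : IsOffDiagAntitone (curvatureMap G Φ) :=
  fun k k' hk hle f hf => Finset.sum_le_sum fun s _ => by
    rw [← hf]
    exact sideCurvature_antitone (hΦ s.1) (hk f) (hle _)

theorem curvatureMap_injOn [Finite F] : InjOn (curvatureMap G Φ) (Ici 0) := by
  have hle : ∀ k ∈ Ici (0 : F → ℝ), ∀ k' ∈ Ici (0 : F → ℝ),
      curvatureMap G Φ k = curvatureMap G Φ k' → k' ≤ k := fun k hk k' hk' h => by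
    refine (isOffDiagAntitone_curvatureMap G hΦ).le_of_apply_le
      (fun _ _ _ => curvatureMap_lt_curvatureMap_smul G) hk hk' (fun f => ?_) h.ge
    rw [← curvatureMap_pos_iff G (hk f), ← curvatureMap_pos_iff G (hk' f), h]
    exact id
  exact fun k hk k' hk' h => le_antisymm (hle k' hk' k hk h.symm) (hle k hk k' hk' h)

theorem isAdmissible_curvatureMap (hk : 0 ≤ k) : IsAdmissible G Φ (curvatureMap G Φ k) :=
  fun F' hF' => by
    rw [sum_curvatureMap, Finset.mul_sum]
    exact Finset.sum_lt_sum_of_nonempty (G.edgesOf_nonempty hF') fun e _ =>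
      edgeCurvature_lt G (hΦ e) hk F'

theorem exists_tendsto_of_curvatureMap_le [Finite F] {α : Type*} {U : Ultrafilter α}
    {κ v : α → F → ℝ} (hκ : ∀ᶠ n in U, 0 ≤ κ n) {L : F → ℝ} (hv : Tendsto v U (𝓝 L))
    (hle : ∀ᶠ n in U, curvatureMap G Φ (κ n) ≤ v n) (hL : IsAdmissible G Φ L) :
    ∃ k, Tendsto κ U (𝓝 k) := by
  classical
  have := Fintype.ofFinite F
  let F' : Finset F := Finset.univ.filter fun f => Tendsto (κ · f) U atTop
  have htop : ∀ f ∈ F', Tendsto (κ · f) U atTop := fun f hf => (Finset.mem_filter.1 hf).2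
  have hbdd : ∀ f ∉ F', ∃ M, ∀ᶠ n in U, κ n f ≤ M := fun f hf =>
    (tendsto_atTop_or_eventually_le U (κ · f)).resolve_left fun h =>
      hf (Finset.mem_filter.2 ⟨Finset.mem_univ f, h⟩)
  have hF' : F' = ∅ := by
    by_contra hne
    have hsum : Tendsto (fun n => ∑ f ∈ F', curvatureMap G Φ (κ n) f) U
        (𝓝 (2 * ∑ e ∈ G.edgesOf F', Φ e)) := by
      simp only [sum_curvatureMap, Finset.mul_sum]
      exact tendsto_finsetSum _ fun e he =>
        tendsto_edgeCurvature G hκ htop hbdd (hΦ e) (G.mem_edgesOf.1 he)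
    have hvsum : Tendsto (fun n => ∑ f ∈ F', v n f) U (𝓝 (∑ f ∈ F', L f)) :=
      tendsto_finsetSum _ fun f _ => tendsto_pi_nhds.1 hv f
    refine (hL F' (Finset.nonempty_iff_ne_empty.2 hne)).not_ge
      (le_of_tendsto_of_tendsto hsum hvsum ?_)
    exact hle.mono fun n hn => Finset.sum_le_sum fun f _ => hn f
  choose M hM using fun f => hbdd f (hF' ▸ Finset.notMem_empty f)
  have hIcc : ∀ᶠ n in U, κ n ∈ Icc 0 M := by
    filter_upwards [hκ, eventually_all.2 hM] with n h0 h1 using ⟨h0, h1⟩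
  obtain ⟨k, -, hk⟩ := isCompact_Icc.ultrafilter_le_nhds (U.map κ) (le_principal_iff.2 hIcc)
  exact ⟨k, hk⟩

theorem isCompact_setOf_curvatureMap_le [Finite F] {L : F → ℝ} (hL : IsAdmissible G Φ L) :
    IsCompact {k | 0 ≤ k ∧ curvatureMap G Φ k ≤ L} := by
  refine isCompact_iff_ultrafilter_le_nhds.2 fun U hU => ?_
  have hmem : ∀ᶠ k in U, 0 ≤ k ∧ curvatureMap G Φ k ≤ L := le_principal_iff.1 hU
  obtain ⟨k, hk⟩ := exists_tendsto_of_curvatureMap_le G hΦ (hmem.mono fun _ => And.left)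
    tendsto_const_nhds (hmem.mono fun _ => And.right) hL
  refine ⟨k, IsClosed.mem_of_tendsto ?_ hk hmem, hk⟩
  exact (isClosed_le continuous_const continuous_id).inter
    (isClosed_le (continuous_curvatureMap G) continuous_const)

theorem exists_curvatureMap_eq [Finite F] {L : F → ℝ} (h0 : 0 ≤ L) (hL : IsAdmissible G Φ L) :
    ∃ k, 0 ≤ k ∧ curvatureMap G Φ k = L := by
  refine (isOffDiagAntitone_curvatureMap G hΦ).exists_apply_eq (continuous_curvatureMap G) ?_
    (isCompact_setOf_curvatureMap_le G hΦ hL)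
  exact fun f => (not_lt.1 fun h => ((curvatureMap_pos_iff G le_rfl).1 h).false).trans (h0 f)

end

/-! ### The strata of `𝓛` -/

section

variable {E F : Type*} [Fintype E] (G : FlagGluing E F) {Φ : E → ℝ} {k : F → ℝ}

theorem nonneg_of_mem_orthantStratum {I : Finset F} (h : k ∈ orthantStratum I) : 0 ≤ k :=
  fun f => by
    by_cases hf : f ∈ I
    · exact (h.1 f hf).le
    · exact (h.2 f hf).ge

theorem orthantStratum_empty : orthantStratum (∅ : Finset F) = {0} := by
  ext k
  simp [orthantStratum, funext_iff]

theorem mem_orthantStratum_univ [Fintype F] : k ∈ orthantStratum Finset.univ ↔ ∀ f, 0 < k f := by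
  simp [orthantStratum]

theorem mem_orthantStratum_support [Fintype F] [DecidablePred fun f => 0 < k f] (hk : 0 ≤ k) :
    k ∈ orthantStratum (Finset.univ.filter fun f => 0 < k f) :=
  ⟨fun f hf => by simpa using hf, fun f hf => le_antisymm (by simpa using hf) (hk f)⟩

theorem LStratum_empty : LStratum G Φ ∅ = {0} := by
  ext L
  simp only [LStratum, orthantStratum_empty, Finset.subset_empty, Set.mem_ofPred_eq,
    mem_singleton_iff, and_iff_left_iff_imp]
  rintro - F' rfl h
  exact absurd h Finset.not_nonempty_empty

theorem L₁_eq_LStratum [Fintype F] : L₁ G Φ = LStratum G Φ Finset.univ := by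
  ext L
  simp [L₁, LStratum, mem_orthantStratum_univ]

theorem LSet_eq_iUnion [Fintype F] : LSet G Φ = ⋃ I, LStratum G Φ I := by
  ext L
  simp only [LSet, LBoundary, L₁_eq_LStratum, ← LStratum_empty G (Φ := Φ), mem_union, mem_iUnion]
  refine ⟨?_, fun ⟨I, hL⟩ => ?_⟩
  · rintro (hL | ⟨I, -, -, hL⟩ | hL)
    exacts [⟨_, hL⟩, ⟨I, hL⟩, ⟨_, hL⟩]
  · by_cases huniv : I = Finset.univ
    · exact Or.inl (huniv ▸ hL)
    rcases I.eq_empty_or_nonempty with rfl | hI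
    exacts [Or.inr (Or.inr hL), Or.inr (Or.inl ⟨I, hI, huniv, hL⟩)]

theorem LStratum_eq_inter (hΦ : ∀ e, 0 < Φ e) (I : Finset F) :
    LStratum G Φ I = orthantStratum I ∩ {L | IsAdmissible G Φ L} := by
  classical
  ext L
  refine ⟨fun h => ⟨h.1, fun F' hF' => ?_⟩, fun h => ⟨h.1, fun F' _ hF' => h.2 F' hF'⟩⟩
  have hsum : ∑ f ∈ F', L f = ∑ f ∈ F' ∩ I, L f :=
    (Finset.sum_subset Finset.inter_subset_left fun f hf hfI =>
      h.1.2 f fun hI => hfI (Finset.mem_inter.2 ⟨hf, hI⟩)).symm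
  rw [hsum]
  rcases (F' ∩ I).eq_empty_or_nonempty with hempty | hne
  · rw [hempty, Finset.sum_empty]
    exact mul_pos two_pos (Finset.sum_pos (fun e _ => hΦ e) (G.edgesOf_nonempty hF'))
  · refine (h.2 _ Finset.inter_subset_right hne).trans_le ?_
    gcongr
    · exact fun e _ _ => (hΦ e).le
    · exact G.edgesOf_mono Finset.inter_subset_left

theorem mem_LSet_iff [Fintype F] (hΦ : ∀ e, 0 < Φ e) {L : F → ℝ} :
    L ∈ LSet G Φ ↔ 0 ≤ L ∧ IsAdmissible G Φ L := by
  classical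
  simp only [LSet_eq_iUnion, LStratum_eq_inter G hΦ, mem_iUnion]
  exact ⟨fun ⟨_, h1, h2⟩ => ⟨nonneg_of_mem_orthantStratum h1, h2⟩,
    fun h => ⟨_, mem_orthantStratum_support h.1, h.2⟩⟩

variable (hΦ : ∀ e, Φ e ∈ Ioo 0 π)
include hΦ

theorem curvatureMap_mem_LStratum_iff (hk : 0 ≤ k) (I : Finset F) :
    curvatureMap G Φ k ∈ LStratum G Φ I ↔ k ∈ orthantStratum I := by
  have hzero : ∀ f, curvatureMap G Φ k f = 0 ↔ k f = 0 := fun f =>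
    not_iff_not.1 <| (curvatureMap_nonneg G hk f).lt_iff_ne'.symm.trans <|
      (curvatureMap_pos_iff G (hk f)).trans (hk f).lt_iff_ne'
  rw [LStratum_eq_inter G fun e => (hΦ e).1, mem_inter_iff, Set.mem_ofPred_eq,
    and_iff_left (isAdmissible_curvatureMap G hΦ hk)]
  simp only [orthantStratum, Set.mem_ofPred_eq, curvatureMap_pos_iff G (hk _), hzero]

theorem curvatureMap_mem_L₁_iff (hk : 0 ≤ k) : curvatureMap G Φ k ∈ L₁ G Φ ↔ ∀ f, 0 < k f :=
  (and_iff_left (isAdmissible_curvatureMap G hΦ hk)).trans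
    (forall_congr' fun f => curvatureMap_pos_iff G (hk f))

variable [Fintype F]

theorem curvatureMap_mem_LBoundary_iff (hk : 0 ≤ k) :
    curvatureMap G Φ k ∈ LBoundary G Φ ↔ k ∈ orthantBoundary := by
  rw [LBoundary, orthantBoundary]
  nth_rw 1 [← LStratum_empty G (Φ := Φ)]
  simp only [← orthantStratum_empty, mem_union, mem_iUnion, curvatureMap_mem_LStratum_iff G hΦ hk]

theorem bijOn_curvatureMap : BijOn (curvatureMap G Φ) {k | ∀ f, 0 ≤ k f} (LSet G Φ) := by
  refine ⟨fun k hk => ?_, curvatureMap_injOn G hΦ, fun L hL => ?_⟩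
  · exact (mem_LSet_iff G fun e => (hΦ e).1).2
      ⟨curvatureMap_nonneg G hk, isAdmissible_curvatureMap G hΦ hk⟩
  · obtain ⟨h0, hL⟩ := (mem_LSet_iff G fun e => (hΦ e).1).1 hL
    exact exists_curvatureMap_eq G hΦ h0 hL

theorem isProperMap_mapsTo_restrict_curvatureMap :
    IsProperMap ((bijOn_curvatureMap G hΦ).mapsTo.restrict) := by
  refine isProperMap_iff_ultrafilter.2
    ⟨(continuous_curvatureMap G).restrict _, fun U L hU => ?_⟩
  have hv : Tendsto (fun k : {k : F → ℝ | ∀ f, 0 ≤ k f} => curvatureMap G Φ k) U (𝓝 L) :=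
    (continuous_subtype_val.tendsto L).comp hU
  obtain ⟨k, hk⟩ := exists_tendsto_of_curvatureMap_le G hΦ (Eventually.of_forall fun k => k.2) hv
    (Eventually.of_forall fun _ => le_rfl) ((mem_LSet_iff G fun e => (hΦ e).1).1 L.2).2
  have hk0 : 0 ≤ k := ge_of_tendsto' hk fun k => k.2
  refine ⟨⟨k, hk0⟩, Subtype.ext ?_, tendsto_subtype_rng.2 hk⟩
  exact tendsto_nhds_unique (((continuous_curvatureMap G).tendsto k).comp hk) hv

/-- The curvature map as a homeomorphism from the nonnegative orthant onto `𝓛`. -/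
def curvatureHomeomorph : {k : F → ℝ // ∀ f, 0 ≤ k f} ≃ₜ LSet G Φ :=
  ((bijOn_curvatureMap G hΦ).equiv _).toHomeomorphOfContinuousClosed
    (isProperMap_mapsTo_restrict_curvatureMap G hΦ).continuous
    (isProperMap_mapsTo_restrict_curvatureMap G hΦ).isClosedMap

theorem coe_curvatureHomeomorph (k : {k : F → ℝ // ∀ f, 0 ≤ k f}) :
    (curvatureHomeomorph G hΦ k : F → ℝ) = curvatureMap G Φ k := rfl

end

/-! ### The length of a circular arc -/

section

open MeasureTheory Measure NNReal

variable {X : Type*} [MetricSpace X] [MeasurableSpace X] [BorelSpace X] {γ : ℝ → X}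

theorem mul_volume_le_hausdorffMeasure_image {c : ℝ≥0} {s : Set ℝ}
    (h : ∀ x ∈ s, ∀ y ∈ s, c * |x - y| ≤ dist (γ x) (γ y)) :
    c * volume s ≤ hausdorffMeasure 1 (γ '' s) := by
  rcases eq_zero_or_pos c with rfl | hc
  · simp
  have hanti : AntilipschitzWith c⁻¹ (s.domRestrict γ) :=
    AntilipschitzWith.of_le_mul_dist fun x y => by
      rw [NNReal.coe_inv, ← div_eq_inv_mul, le_div_iff₀' (NNReal.coe_pos.2 hc)]
      exact h x x.2 y y.2
  have hs : hausdorffMeasure 1 (univ : Set s) = volume s := by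
    rw [← isometry_subtype_coe.hausdorffMeasure_image (Or.inl zero_le_one), image_univ,
      Subtype.range_coe, hausdorffMeasure_real]
  have hle := hanti.le_hausdorffMeasure_image zero_le_one univ
  rw [hs, image_univ, range_domRestrict, ENNReal.rpow_one, ENNReal.coe_inv hc.ne'] at hle
  exact (ENNReal.mul_le_iff_le_inv (ENNReal.coe_ne_zero.2 hc.ne') ENNReal.coe_ne_top).2 hle

theorem mul_volume_le_hausdorffMeasure_image_Ioo {c : ℝ≥0} {δ : ℝ} (hδ : 0 < δ)
    (hγ : Continuous γ) (h : ∀ x y, |x - y| ≤ δ → c * |x - y| ≤ dist (γ x) (γ y)) {a b : ℝ}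
    (hinj : InjOn γ (Ioo a b)) :
    c * volume (Ioo a b) ≤ hausdorffMeasure 1 (γ '' Ioo a b) := by
  obtain ⟨n, hn⟩ := pow_unbounded_of_one_lt ((b - a) / δ) one_lt_two
  replace hn : b - a ≤ 2 ^ n * δ := ((div_lt_iff₀ hδ).1 hn).le
  induction n generalizing a b with
  | zero =>
    refine mul_volume_le_hausdorffMeasure_image fun x hx y hy => h x y ?_
    rw [abs_le]
    constructor <;> linarith [hx.1, hx.2, hy.1, hy.2]
  | succ n ih =>
    rcases lt_or_ge b a with hab | hab
    · simp [Ioo_eq_empty hab.not_gt]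
    set m := (a + b) / 2 with hm
    have ham : a ≤ m := by linarith
    have hmb : m ≤ b := by linarith
    have hleft : Ioo a m ⊆ Ioo a b := Ioo_subset_Ioo_right hmb
    have hright : Ioo m b ⊆ Ioo a b := Ioo_subset_Ioo_left ham
    rw [pow_succ] at hn
    have hdisj : Disjoint (γ '' Ioo a m) (γ '' Ioo m b) :=
      (Ioo_disjoint_Ioo.2 (by simp [hmb])).image hinj hleft hright
    calc c * volume (Ioo a b) = c * volume (Ioo a m) + c * volume (Ioo m b) := by
          rw [← mul_add, Real.volume_Ioo, Real.volume_Ioo, Real.volume_Ioo,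
            ← ENNReal.ofReal_add (sub_nonneg.2 ham) (sub_nonneg.2 hmb)]
          ring_nf
      _ ≤ hausdorffMeasure 1 (γ '' Ioo a m) + hausdorffMeasure 1 (γ '' Ioo m b) :=
          add_le_add (ih (hinj.mono hleft) (by linarith)) (ih (hinj.mono hright) (by linarith))
      _ = hausdorffMeasure 1 (γ '' Ioo a m ∪ γ '' Ioo m b) := (measure_union hdisj <|
          measurableSet_Ioo.image_of_continuousOn_injOn hγ.continuousOn (hinj.mono hright)).symm
      _ ≤ hausdorffMeasure 1 (γ '' Ioo a b) := by
          rw [← image_union]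
          exact measure_mono (image_mono (union_subset hleft hright))

theorem hausdorffMeasure_image_Ioo {ρ : ℝ≥0} (hlip : LipschitzWith ρ γ)
    (hloc : ∀ c < ρ, ∃ δ > 0, ∀ x y, |x - y| ≤ δ → c * |x - y| ≤ dist (γ x) (γ y)) {a b : ℝ}
    (hinj : InjOn γ (Ioo a b)) :
    hausdorffMeasure 1 (γ '' Ioo a b) = ρ * volume (Ioo a b) := by
  refine le_antisymm ?_ ?_
  · have h := hlip.hausdorffMeasure_image_le zero_le_one (Ioo a b)
    rwa [ENNReal.rpow_one, hausdorffMeasure_real] at h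
  · rcases eq_or_ne (volume (Ioo a b)) 0 with h0 | h0
    · simp [h0]
    have htop : volume (Ioo a b) ≠ ⊤ := measure_Ioo_lt_top.ne
    rw [← ENNReal.le_div_iff_mul_le (Or.inl h0) (Or.inl htop)]
    refine ENNReal.le_of_forall_nnreal_lt fun c hc => ?_
    obtain ⟨δ, hδ, h⟩ := hloc c (ENNReal.coe_lt_coe.1 hc)
    rw [ENNReal.le_div_iff_mul_le (Or.inl h0) (Or.inl htop)]
    exact mul_volume_le_hausdorffMeasure_image_Ioo hδ hlip.continuous h hinj

theorem hausdorffMeasure_circularArc {ρ : ℝ} (hρ : 0 < ρ)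
    (hγ : ∀ s t, dist (γ s) (γ t) = 2 * ρ * |sin ((s - t) / 2)|) {a b : ℝ} (hab : b - a ≤ 2 * π) :
    hausdorffMeasure 1 (γ '' Ioo a b) = ENNReal.ofReal (ρ * (b - a)) := by
  lift ρ to ℝ≥0 using hρ.le
  have hlip : LipschitzWith ρ γ := LipschitzWith.of_dist_le_mul fun s t => by
    have h : |sin ((s - t) / 2)| ≤ |(s - t) / 2| := abs_sin_le_abs
    rw [abs_div, abs_two] at h
    rw [hγ, Real.dist_eq]
    nlinarith
  have hinj : InjOn γ (Ioo a b) := fun s hs t ht hst => by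
    have h := hγ s t
    rw [hst, dist_self, eq_comm, mul_eq_zero, or_iff_right (by positivity), abs_eq_zero,
      sin_eq_zero_iff_of_lt_of_lt (by linarith [hs.1, ht.2]) (by linarith [ht.1, hs.2])] at h
    linarith
  rw [hausdorffMeasure_image_Ioo hlip (fun c hc => ?_) hinj, Real.volume_Ioo,
    ENNReal.ofReal_mul ρ.coe_nonneg, ENNReal.ofReal_coe_nnreal]
  have hsinc : Tendsto (fun x => ρ * sinc (x / 2)) (𝓝 0) (𝓝 ρ) := by
    have h : Continuous fun x => ρ * sinc (x / 2) := by fun_prop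
    simpa using h.tendsto 0
  obtain ⟨δ, hδ, h⟩ := Metric.eventually_nhds_iff.1 (hsinc.eventually_const_lt (coe_lt_coe.2 hc))
  refine ⟨δ / 2, half_pos hδ, fun s t hst => ?_⟩
  rcases eq_or_ne s t with rfl | hne
  · simp
  have hs : (c : ℝ) < ρ * sinc ((s - t) / 2) := h (by rw [dist_zero_right, norm_eq_abs]; linarith)
  rw [sinc_of_ne_zero (div_ne_zero (sub_ne_zero.2 hne) two_ne_zero)] at hs
  have hst0 : |s - t| ≠ 0 := abs_ne_zero.2 (sub_ne_zero.2 hne)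
  calc (c : ℝ) * |s - t| ≤ |ρ * (sin ((s - t) / 2) / ((s - t) / 2))| * |s - t| := by
        gcongr
        exact hs.le.trans (le_abs_self _)
    _ = dist (γ s) (γ t) := by
        rw [hγ, abs_mul, abs_div, abs_div, abs_two, abs_of_pos hρ]
        field_simp [hst0]

end

/-! ### Lenses on the sphere -/

theorem exists_linearIsometryEquiv_of_inner_eq {ι V : Type*} [Finite ι] [NormedAddCommGroup V]
    [InnerProductSpace ℝ V] {v w : ι → V} (h : ∀ i j, ⟪v i, v j⟫ = ⟪w i, w j⟫) :
    ∃ R : V ≃ₗᵢ[ℝ] V, ∀ i, R (v i) = w i := by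
  classical
  cases nonempty_fintype ι
  suffices H : ∀ s : Finset ι, ∃ R : V ≃ₗᵢ[ℝ] V, ∀ i ∈ s, R (v i) = w i by
    simpa only [Finset.mem_univ, forall_true_left] using H Finset.univ
  intro s
  induction s using Finset.induction_on with
  | empty => exact ⟨.refl ℝ V, by simp⟩
  | insert a s _ ih =>
    obtain ⟨R, hR⟩ := ih
    -- Correct `R` by the reflection that exchanges `R (v a)` and `w a`; it fixes `w i` for `i ∈ s`.
    have hnorm : ‖R (v a)‖ = ‖w a‖ := by
      rw [R.norm_map, norm_eq_sqrt_real_inner, norm_eq_sqrt_real_inner, h]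
    refine ⟨R.trans (ℝ ∙ (R (v a) - w a))ᗮ.reflection, Finset.forall_mem_insert .. |>.2
      ⟨Submodule.reflection_sub hnorm, fun i hi => ?_⟩⟩
    have horth : ⟪R (v a) - w a, w i⟫ = 0 := by
      rw [inner_sub_left, ← h a i, ← hR i hi, R.inner_map_map, sub_self]
    rw [LinearIsometryEquiv.trans_apply, hR i hi]
    exact Submodule.reflection_mem_subspace_eq_self
      (Submodule.mem_orthogonal_singleton_iff_inner_right.2 horth)

section Inner

variable {V : Type*} [NormedAddCommGroup V] [InnerProductSpace ℝ V]

theorem angle_eq_iff_inner_eq {c x : V} (hc : ‖c‖ = 1) (hx : ‖x‖ = 1) {r : ℝ} (hr : r ∈ Icc 0 π) :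
    InnerProductGeometry.angle c x = r ↔ ⟪c, x⟫ = cos r := by
  rw [← injOn_cos.eq_iff ⟨InnerProductGeometry.angle_nonneg c x,
    InnerProductGeometry.angle_le_pi c x⟩ hr, InnerProductGeometry.cos_angle, hc, hx, one_mul,
    div_one]

theorem angle_lt_iff_cos_lt_inner {c x : V} (hc : ‖c‖ = 1) (hx : ‖x‖ = 1) {r : ℝ}
    (hr : r ∈ Icc 0 π) : InnerProductGeometry.angle c x < r ↔ cos r < ⟪c, x⟫ := by
  rw [← strictAntiOn_cos.lt_iff_gt hr ⟨InnerProductGeometry.angle_nonneg c x,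
    InnerProductGeometry.angle_le_pi c x⟩, InnerProductGeometry.cos_angle, hc, hx, one_mul,
    div_one]

theorem inner_sub_inner_smul_self {p : V} (hp : ‖p‖ = 1) (a b : V) :
    ⟪a - ⟪p, a⟫ • p, b - ⟪p, b⟫ • p⟫ = ⟪a, b⟫ - ⟪p, a⟫ * ⟪p, b⟫ := by
  simp only [inner_sub_left, inner_sub_right, real_inner_smul_left, real_inner_smul_right,
    real_inner_self_eq_norm_sq, hp, real_inner_comm p a]
  ring

theorem norm_sub_inner_smul_self {p a : V} (hp : ‖p‖ = 1) (ha : ‖a‖ = 1) {r : ℝ}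
    (hr : r ∈ Icc 0 π) (h : ⟪p, a⟫ = cos r) : ‖a - ⟪p, a⟫ • p‖ = sin r := by
  rw [norm_eq_sqrt_real_inner, inner_sub_inner_smul_self hp, real_inner_self_eq_norm_sq, ha, h,
    sin_eq_sqrt_one_sub_cos_sq hr.1 hr.2]
  ring_nf

theorem angle_map (R : V ≃ₗᵢ[ℝ] V) (x y : V) :
    InnerProductGeometry.angle (R x) (R y) = InnerProductGeometry.angle x y :=
  R.toLinearIsometry.angle_map x y

end Inner

theorem mem_sphCircle_iff {c x : E3} (hc : ‖c‖ = 1) {r : ℝ} (hr : r ∈ Icc 0 π) :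
    x ∈ sphCircle c r ↔ ‖x‖ = 1 ∧ ⟪c, x⟫ = cos r :=
  and_congr_right fun hx => angle_eq_iff_inner_eq hc hx hr

theorem mem_sphDisk_iff {c x : E3} (hc : ‖c‖ = 1) {r : ℝ} (hr : r ∈ Icc 0 π) :
    x ∈ sphDisk c r ↔ ‖x‖ = 1 ∧ cos r < ⟪c, x⟫ :=
  and_congr_right fun hx => angle_lt_iff_cos_lt_inner hc hx hr

theorem image_sphCircle (R : E3 ≃ₗᵢ[ℝ] E3) (c : E3) (r : ℝ) :
    R '' sphCircle c r = sphCircle (R c) r := by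
  ext x
  obtain ⟨x, rfl⟩ := R.surjective x
  simp only [R.injective.mem_set_image, sphCircle, mem_ofPred_eq, R.norm_map, angle_map R]

theorem image_sphDisk (R : E3 ≃ₗᵢ[ℝ] E3) (c : E3) (r : ℝ) :
    R '' sphDisk c r = sphDisk (R c) r := by
  ext x
  obtain ⟨x, rfl⟩ := R.surjective x
  simp only [R.injective.mem_set_image, sphDisk, mem_ofPred_eq, R.norm_map, angle_map R]

theorem pi_sub_sphAngle_eq_iff {p c c' : E3} (hp : ‖p‖ = 1) (hc : ‖c‖ = 1) (hc' : ‖c'‖ = 1)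
    {r r' φ : ℝ} (hr : r ∈ Ioo 0 π) (hr' : r' ∈ Ioo 0 π) (hφ : φ ∈ Icc 0 π)
    (h : ⟪c, p⟫ = cos r) (h' : ⟪c', p⟫ = cos r') :
    π - sphAngle p c c' = φ ↔ ⟪c, c'⟫ = cos r * cos r' - sin r * sin r' * cos φ := by
  rw [real_inner_comm] at h h'
  have hs := sin_pos_of_mem_Ioo hr
  have hs' := sin_pos_of_mem_Ioo hr'
  have hcos : cos (sphAngle p c c') = (⟪c, c'⟫ - cos r * cos r') / (sin r * sin r') := by
    rw [sphAngle, InnerProductGeometry.cos_angle, inner_sub_inner_smul_self hp,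
      norm_sub_inner_smul_self hp hc (Ioo_subset_Icc_self hr) h,
      norm_sub_inner_smul_self hp hc' (Ioo_subset_Icc_self hr') h', h, h']
  have hmem : π - sphAngle p c c' ∈ Icc 0 π :=
    ⟨sub_nonneg.2 (InnerProductGeometry.angle_le_pi _ _),
      sub_le_self _ (InnerProductGeometry.angle_nonneg _ _)⟩
  rw [← injOn_cos.eq_iff hmem hφ, cos_pi_sub, hcos, ← neg_div, div_eq_iff (mul_pos hs hs').ne']
  constructor <;> intro h <;> linarith

/-- The point of the unit sphere at distance `r` from the pole `polar 0 0`, in direction `t`. -/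
def polar (r t : ℝ) : E3 := !₂[cos r, sin r * cos t, sin r * sin t]

theorem inner_polar (r s r' t : ℝ) :
    ⟪polar r s, polar r' t⟫ = cos r * cos r' + sin r * sin r' * cos (s - t) := by
  simp [polar, PiLp.inner_apply, Fin.sum_univ_three, cos_sub]
  ring

theorem norm_polar (r t : ℝ) : ‖polar r t‖ = 1 := by
  rw [norm_eq_sqrt_real_inner, inner_polar, sub_self, cos_zero, mul_one, ← sq, ← sq,
    cos_sq_add_sin_sq, sqrt_one]

theorem dist_polar {r : ℝ} (hr : 0 ≤ sin r) (s t : ℝ) :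
    dist (polar r s) (polar r t) = 2 * sin r * |sin ((s - t) / 2)| := by
  have hsq : dist (polar r s) (polar r t) ^ 2 = (2 * sin r * |sin ((s - t) / 2)|) ^ 2 := by
    have hhalf : cos (s - t) = 1 - 2 * sin ((s - t) / 2) ^ 2 := by
      rw [← cos_two_mul_eq_one_sub]; ring_nf
    rw [dist_eq_norm, norm_sub_sq_real, norm_polar, norm_polar, inner_polar, mul_pow, sq_abs, hhalf]
    linear_combination -2 * sin_sq_add_cos_sq r
  exact (sq_eq_sq₀ dist_nonneg (by positivity)).1 hsq

theorem sphCircle_pole {r : ℝ} (hr : r ∈ Ioo 0 π) :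
    sphCircle (polar 0 0) r = polar r '' Ioc (-π) π := by
  have hs := sin_pos_of_mem_Ioo hr
  ext x
  rw [mem_sphCircle_iff (norm_polar 0 0) (Ioo_subset_Icc_self hr)]
  constructor
  · rintro ⟨hx, h⟩
    have h0 : x 0 = cos r := by
      simpa [polar, PiLp.inner_apply, Fin.sum_univ_three] using h
    let z : ℂ := ⟨x 1, x 2⟩
    have hz : ‖z‖ = sin r := by
      rw [← sq_eq_sq₀ (norm_nonneg _) hs.le, Complex.sq_norm, Complex.normSq_mk]
      have hsum : x 0 ^ 2 + x 1 ^ 2 + x 2 ^ 2 = 1 := by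
        simpa [hx, Fin.sum_univ_three] using (EuclideanSpace.real_norm_sq_eq x).symm
      rw [h0] at hsum
      linear_combination hsum - sin_sq_add_cos_sq r
    refine ⟨z.arg, z.arg_mem_Ioc, ?_⟩
    ext i
    fin_cases i
    · exact h0.symm
    · exact congrArg (· * cos z.arg) hz.symm |>.trans z.norm_mul_cos_arg
    · exact congrArg (· * sin z.arg) hz.symm |>.trans z.norm_mul_sin_arg
  · rintro ⟨t, -, rfl⟩
    exact ⟨norm_polar r t, by rw [inner_polar]; simp⟩

section Lens

/-- The distance of the centers of two circles of radii `r`, `r'` whose disks intersect in a bigon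
with interior angle `φ`, by the spherical law of cosines. -/
def centerDist (r r' φ : ℝ) : ℝ := arccos (cos r * cos r' - sin r * sin r' * cos φ)

/-- Two disks with centers `c`, `c'` and radii `r`, `r'` that intersect in a bigon with corners `p`,
`q` and interior angle `φ`. The angle is encoded, through the spherical law of cosines, in the inner
product of the centers. -/
structure IsLens (c c' p q : E3) (r r' φ : ℝ) : Prop where
  norm_left : ‖c‖ = 1
  norm_right : ‖c'‖ = 1
  norm_corner : ‖p‖ = 1
  norm_corner' : ‖q‖ = 1
  inner_left : ⟪c, p⟫ = cos r
  inner_left' : ⟪c, q⟫ = cos r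
  inner_right : ⟪c', p⟫ = cos r'
  inner_right' : ⟪c', q⟫ = cos r'
  inner_centers : ⟪c, c'⟫ = cos r * cos r' - sin r * sin r' * cos φ
  corner_ne : p ≠ q

variable {c c' p q : E3} {r r' φ : ℝ}

theorem IsLens.symm (h : IsLens c c' p q r r' φ) : IsLens c' c p q r' r φ where
  norm_left := h.norm_right
  norm_right := h.norm_left
  norm_corner := h.norm_corner
  norm_corner' := h.norm_corner'
  inner_left := h.inner_right
  inner_left' := h.inner_right'
  inner_right := h.inner_left
  inner_right' := h.inner_left'
  inner_centers := by rw [real_inner_comm, h.inner_centers]; ring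
  corner_ne := h.corner_ne

theorem one_sub_lawOfCosines_sq (r r' φ : ℝ) :
    1 - (cos r * cos r' - sin r * sin r' * cos φ) ^ 2 =
      (sin r * cos r' + cos r * sin r' * cos φ) ^ 2 + (sin r' * sin φ) ^ 2 := by
  linear_combination (-cos r' ^ 2 - sin r' ^ 2 * cos φ ^ 2) * sin_sq_add_cos_sq r -
    sin_sq_add_cos_sq r' - sin r' ^ 2 * sin_sq_add_cos_sq φ

theorem cos_centerDist (r r' φ : ℝ) :
    cos (centerDist r r' φ) = cos r * cos r' - sin r * sin r' * cos φ := by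
  have h : (cos r * cos r' - sin r * sin r' * cos φ) ^ 2 ≤ 1 :=
    sub_nonneg.1 (one_sub_lawOfCosines_sq r r' φ ▸ by positivity)
  obtain ⟨h1, h2⟩ := abs_le.1 ((sq_le_one_iff_abs_le_one _).1 h)
  exact cos_arccos h1 h2

theorem sin_centerDist_sq (r r' φ : ℝ) : sin (centerDist r r' φ) ^ 2 =
    (sin r * cos r' + cos r * sin r' * cos φ) ^ 2 + (sin r' * sin φ) ^ 2 := by
  rw [sin_sq, cos_centerDist, one_sub_lawOfCosines_sq]

theorem sin_centerDist_pos (hr' : r' ∈ Ioo 0 π) (hφ : φ ∈ Ioo 0 π) :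
    0 < sin (centerDist r r' φ) := by
  have hB := mul_pos (sin_pos_of_mem_Ioo hr') (sin_pos_of_mem_Ioo hφ)
  have hne : sin (centerDist r r' φ) ^ 2 ≠ 0 := by
    rw [sin_centerDist_sq]
    positivity
  exact (sin_nonneg_of_nonneg_of_le_pi (arccos_nonneg _) (arccos_le_pi _)).lt_of_ne'
    (pow_ne_zero_iff two_ne_zero |>.1 hne)

theorem halfAngle_cot (hr : r ∈ Ioo 0 π) (hr' : r' ∈ Ioo 0 π) :
    halfAngle φ (cot r) (cot r') =
      arccot ((sin r * cos r' + cos r * sin r' * cos φ) / (sin r' * sin φ)) := by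
  have hs := (sin_pos_of_mem_Ioo hr).ne'
  have hs' := (sin_pos_of_mem_Ioo hr').ne'
  rw [halfAngle, arccot_cot hr, cot_eq_cos_div_sin, cot_eq_cos_div_sin, div_mul_eq_div_div]
  congr 2
  field_simp

theorem sin_centerDist_mul_cos_halfAngle (hr : r ∈ Ioo 0 π) (hr' : r' ∈ Ioo 0 π)
    (hφ : φ ∈ Ioo 0 π) : sin (centerDist r r' φ) * cos (halfAngle φ (cot r) (cot r')) =
      sin r * cos r' + cos r * sin r' * cos φ := by
  have hd := sin_centerDist_pos (r := r) hr' hφ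
  have hB := mul_pos (sin_pos_of_mem_Ioo hr') (sin_pos_of_mem_Ioo hφ)
  rw [halfAngle_cot hr hr', ← sin_arccot_mul]
  set A := sin r * cos r' + cos r * sin r' * cos φ with hA
  set B := sin r' * sin φ
  have hθ := sin_pos_of_mem_Ioo (arccot_mem_Ioo (A / B))
  have hsq : (sin (centerDist r r' φ) * sin (arccot (A / B))) ^ 2 = B ^ 2 := by
    have hcos := sin_arccot_mul (A / B)
    rw [mul_div_assoc', div_eq_iff hB.ne'] at hcos
    rw [mul_pow, sin_centerDist_sq, ← hA]
    linear_combination (sin (arccot (A / B)) * A + cos (arccot (A / B)) * B) * hcos +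
      B ^ 2 * sin_sq_add_cos_sq (arccot (A / B))
  rw [← mul_assoc, (sq_eq_sq₀ (mul_pos hd hθ).le hB.le).1 hsq, mul_div_cancel₀ _ hB.ne']

theorem inner_polar_centerDist (hr : r ∈ Ioo 0 π) (hr' : r' ∈ Ioo 0 π) (hφ : φ ∈ Ioo 0 π) (t : ℝ) :
    ⟪polar (centerDist r r' φ) 0, polar r t⟫ = cos r' +
      sin (centerDist r r' φ) * sin r * (cos t - cos (halfAngle φ (cot r) (cot r'))) := by
  rw [inner_polar, zero_sub, cos_neg, cos_centerDist]
  linear_combination sin r * sin_centerDist_mul_cos_halfAngle hr hr' hφ +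
    cos r' * sin_sq_add_cos_sq r

theorem inner_polar_centerDist_eq_iff (hr : r ∈ Ioo 0 π) (hr' : r' ∈ Ioo 0 π) (hφ : φ ∈ Ioo 0 π)
    {t : ℝ} (ht : t ∈ Icc (-π) π) : ⟪polar (centerDist r r' φ) 0, polar r t⟫ = cos r' ↔
      |t| = halfAngle φ (cot r) (cot r') := by
  have hpos := mul_pos (sin_centerDist_pos (r := r) hr' hφ) (sin_pos_of_mem_Ioo hr)
  rw [inner_polar_centerDist hr hr' hφ, add_eq_left, mul_eq_zero_iff_left hpos.ne', sub_eq_zero,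
    ← cos_abs, injOn_cos.eq_iff ⟨abs_nonneg t, abs_le.2 ht⟩
      (Ioo_subset_Icc_self (halfAngle_mem_Ioo _ _ _))]

theorem cos_lt_inner_polar_centerDist_iff (hr : r ∈ Ioo 0 π) (hr' : r' ∈ Ioo 0 π)
    (hφ : φ ∈ Ioo 0 π) {t : ℝ} (ht : t ∈ Icc (-π) π) :
    cos r' < ⟪polar (centerDist r r' φ) 0, polar r t⟫ ↔
      |t| < halfAngle φ (cot r) (cot r') := by
  have hpos := mul_pos (sin_centerDist_pos (r := r) hr' hφ) (sin_pos_of_mem_Ioo hr)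
  rw [inner_polar_centerDist hr hr' hφ, lt_add_iff_pos_right, mul_pos_iff_of_pos_left hpos, sub_pos,
    ← cos_abs t, strictAntiOn_cos.lt_iff_gt (Ioo_subset_Icc_self (halfAngle_mem_Ioo _ _ _))
      ⟨abs_nonneg t, abs_le.2 ht⟩]

theorem sphCircle_inter_sphDisk_pole (hr : r ∈ Ioo 0 π) (hr' : r' ∈ Ioo 0 π) (hφ : φ ∈ Ioo 0 π) :
    sphCircle (polar 0 0) r ∩ sphDisk (polar (centerDist r r' φ) 0) r' =
      polar r '' Ioo (-halfAngle φ (cot r) (cot r')) (halfAngle φ (cot r) (cot r')) := by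
  have hθ := (halfAngle_mem_Ioo φ (cot r) (cot r')).2
  rw [sphCircle_pole hr]
  ext x
  constructor
  · rintro ⟨⟨t, ht, rfl⟩, hx⟩
    have hlt := ((mem_sphDisk_iff (norm_polar _ _) (Ioo_subset_Icc_self hr')).1 hx).2
    exact ⟨t, abs_lt.1 ((cos_lt_inner_polar_centerDist_iff hr hr' hφ
      (Ioc_subset_Icc_self ht)).1 hlt), rfl⟩
  · rintro ⟨t, ht, rfl⟩
    have htπ : t ∈ Ioc (-π) π := ⟨by linarith [ht.1], by linarith [ht.2]⟩
    exact ⟨⟨t, htπ, rfl⟩, (mem_sphDisk_iff (norm_polar _ _) (Ioo_subset_Icc_self hr')).2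
      ⟨norm_polar r t, (cos_lt_inner_polar_centerDist_iff hr hr' hφ
        (Ioc_subset_Icc_self htπ)).2 (abs_lt.2 ht)⟩⟩

theorem isLens_polar (hr : r ∈ Ioo 0 π) (hr' : r' ∈ Ioo 0 π) (hφ : φ ∈ Ioo 0 π) :
    IsLens (polar 0 0) (polar (centerDist r r' φ) 0) (polar r (halfAngle φ (cot r) (cot r')))
      (polar r (-halfAngle φ (cot r) (cot r'))) r r' φ where
  norm_left := norm_polar _ _
  norm_right := norm_polar _ _
  norm_corner := norm_polar _ _
  norm_corner' := norm_polar _ _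
  inner_left := by simp [inner_polar]
  inner_left' := by simp [inner_polar]
  inner_right := by simp [inner_polar_centerDist hr hr' hφ]
  inner_right' := by simp [inner_polar_centerDist hr hr' hφ]
  inner_centers := by simp [inner_polar, cos_centerDist]
  corner_ne := fun h => by
    have hz : sin r * sin _ = sin r * sin (-_) := congrArg (fun v : E3 => v 2) h
    have hpos := mul_pos (sin_pos_of_mem_Ioo hr)
      (sin_pos_of_mem_Ioo (halfAngle_mem_Ioo φ (cot r) (cot r')))
    rw [sin_neg] at hz
    linarith

theorem IsLens.inner_eq {c₁ c₁' p₁ q₁ : E3} (h : IsLens c c' p q r r' φ)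
    (h₁ : IsLens c₁ c₁' p₁ q₁ r r' φ) (i j : Fin 3) :
    ⟪![c, c', p] i, ![c, c', p] j⟫ = ⟪![c₁, c₁', p₁] i, ![c₁, c₁', p₁] j⟫ := by
  fin_cases i <;> fin_cases j <;>
    simp [real_inner_comm c c', real_inner_comm c p, real_inner_comm c' p, real_inner_comm c₁ c₁',
      real_inner_comm c₁ p₁, real_inner_comm c₁' p₁, h.norm_left, h.norm_right, h.norm_corner,
      h.inner_left, h.inner_right, h.inner_centers, h₁.norm_left, h₁.norm_right, h₁.norm_corner,
      h₁.inner_left, h₁.inner_right, h₁.inner_centers]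

theorem IsLens.exists_eq_polar (h : IsLens c c' p q r r' φ) (hr : r ∈ Ioo 0 π)
    (hr' : r' ∈ Ioo 0 π) (hφ : φ ∈ Ioo 0 π) :
    ∃ R : E3 ≃ₗᵢ[ℝ] E3, R (polar 0 0) = c ∧ R (polar (centerDist r r' φ) 0) = c' ∧
      R (polar r (halfAngle φ (cot r) (cot r'))) = p ∧
      R (polar r (-halfAngle φ (cot r) (cot r'))) = q := by
  obtain ⟨R, hR⟩ := exists_linearIsometryEquiv_of_inner_eq ((isLens_polar hr hr' hφ).inner_eq h)
  have hc : R (polar 0 0) = c := hR 0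
  have hc' : R (polar (centerDist r r' φ) 0) = c' := hR 1
  have hp : R (polar r (halfAngle φ (cot r) (cot r'))) = p := hR 2
  refine ⟨R, hc, hc', hp, ?_⟩
  obtain ⟨x, rfl⟩ := R.surjective q
  have hx : x ∈ sphCircle (polar 0 0) r :=
    (mem_sphCircle_iff (norm_polar 0 0) (Ioo_subset_Icc_self hr)).2
      ⟨(R.norm_map x).symm.trans h.norm_corner', by rw [← R.inner_map_map, hc, h.inner_left']⟩
  rw [sphCircle_pole hr] at hx
  obtain ⟨t, ht, rfl⟩ := hx
  have hinner : ⟪polar (centerDist r r' φ) 0, polar r t⟫ = cos r' := by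
    rw [← R.inner_map_map, hc', h.inner_right']
  rcases eq_or_eq_neg_of_abs_eq ((inner_polar_centerDist_eq_iff hr hr' hφ
    (Ioc_subset_Icc_self ht)).1 hinner) with rfl | rfl
  · exact absurd hp.symm h.corner_ne
  · rfl

theorem IsLens.exists_congruence {c₁ c₁' p₁ q₁ : E3} (h : IsLens c c' p q r r' φ)
    (h₁ : IsLens c₁ c₁' p₁ q₁ r r' φ) (hr : r ∈ Ioo 0 π) (hr' : r' ∈ Ioo 0 π) (hφ : φ ∈ Ioo 0 π) :
    ∃ R : E3 ≃ₗᵢ[ℝ] E3, R c = c₁ ∧ R c' = c₁' ∧ R p = p₁ ∧ R q = q₁ := by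
  obtain ⟨R, rfl, rfl, rfl, rfl⟩ := h.exists_eq_polar hr hr' hφ
  obtain ⟨R₁, rfl, rfl, rfl, rfl⟩ := h₁.exists_eq_polar hr hr' hφ
  exact ⟨R.symm.trans R₁, by simp, by simp, by simp, by simp⟩

theorem IsLens.hausdorffMeasure_side (h : IsLens c c' p q r r' φ) (hr : r ∈ Ioo 0 π)
    (hr' : r' ∈ Ioo 0 π) (hφ : φ ∈ Ioo 0 π) :
    MeasureTheory.Measure.hausdorffMeasure 1 (sphCircle c r ∩ sphDisk c' r') =
      ENNReal.ofReal (sin r * (2 * halfAngle φ (cot r) (cot r'))) := by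
  have hs := sin_pos_of_mem_Ioo hr
  have hθ := (halfAngle_mem_Ioo φ (cot r) (cot r')).2
  obtain ⟨R, rfl, rfl, -, -⟩ := h.exists_eq_polar hr hr' hφ
  rw [← image_sphCircle, ← image_sphDisk, ← image_inter R.injective,
    R.isometry.hausdorffMeasure_image (.inl zero_le_one), sphCircle_inter_sphDisk_pole hr hr' hφ,
    hausdorffMeasure_circularArc hs (dist_polar hs.le) (by linarith)]
  ring_nf

end Lens

/-! ### Spherical conical metrics -/

namespace SphericalConicalMetric

variable {S E F : Type*} [TopologicalSpace S] {D : CellularDecomposition S E F} {Φ : E → ℝ}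

theorem radius_mem_Ioo (μ : SphericalConicalMetric D Φ) (f : F) : μ.radius f ∈ Ioo 0 π :=
  ⟨(μ.radius_mem f).1, (μ.radius_mem f).2.trans_lt (half_lt_self pi_pos)⟩

theorem arccot_geodesicCurvature (μ : SphericalConicalMetric D Φ) (f : F) :
    arccot (μ.geodesicCurvature f) = μ.radius f := arccot_cot (μ.radius_mem_Ioo f)

theorem geodesicCurvature_nonneg (μ : SphericalConicalMetric D Φ) : 0 ≤ μ.geodesicCurvature :=
  fun f => by
    have hr := μ.radius_mem f
    rw [Pi.zero_apply, geodesicCurvature, cot_eq_cos_div_sin]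
    exact div_nonneg (cos_nonneg_of_mem_Icc ⟨by linarith [hr.1, pi_pos], hr.2⟩)
      (sin_pos_of_mem_Ioo (μ.radius_mem_Ioo f)).le

theorem radius_eq_of_geodesicCurvature_eq {μ ν : SphericalConicalMetric D Φ}
    (h : μ.geodesicCurvature = ν.geodesicCurvature) : μ.radius = ν.radius := funext fun f => by
  rw [← arccot_geodesicCurvature, h, arccot_geodesicCurvature]

theorem isLens (hΦ : ∀ e, Φ e ∈ Ioo 0 π) (μ : SphericalConicalMetric D Φ) (e : E) (b : Bool) :
    IsLens (μ.center e b) (μ.center e !b) (μ.corner e false) (μ.corner e true)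
      (μ.sideRadius e b) (μ.sideRadius e !b) (Φ e) := by
  have hr (b) : μ.sideRadius e b ∈ Ioo 0 π := μ.radius_mem_Ioo _
  have hcorner (b h) := (mem_sphCircle_iff (μ.norm_center e b)
    (Ioo_subset_Icc_self (hr b))).1 (μ.corner_mem e b h)
  have hlens : IsLens (μ.center e false) (μ.center e true) (μ.corner e false) (μ.corner e true)
      (μ.sideRadius e false) (μ.sideRadius e true) (Φ e) :=
    { norm_left := μ.norm_center e _
      norm_right := μ.norm_center e _
      norm_corner := (hcorner false _).1
      norm_corner' := (hcorner false _).1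
      inner_left := (hcorner _ _).2
      inner_left' := (hcorner _ _).2
      inner_right := (hcorner _ _).2
      inner_right' := (hcorner _ _).2
      inner_centers := (pi_sub_sphAngle_eq_iff (hcorner false false).1 (μ.norm_center e _)
        (μ.norm_center e _) (hr _) (hr _) (Ioo_subset_Icc_self (hΦ e)) (hcorner _ _).2
        (hcorner _ _).2).1 (μ.angle_corner e false)
      corner_ne := μ.corner_ne e }
  cases b
  exacts [hlens, hlens.symm]

theorem sideLength_eq (hΦ : ∀ e, Φ e ∈ Ioo 0 π) (μ : SphericalConicalMetric D Φ) (e : E)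
    (b : Bool) : μ.sideLength e b = sin (μ.sideRadius e b) *
      (2 * halfAngle (Φ e) (cot (μ.sideRadius e b)) (cot (μ.sideRadius e !b))) := by
  have hr : μ.sideRadius e b ∈ Ioo 0 π := μ.radius_mem_Ioo _
  rw [sideLength, bigonSide, (μ.isLens hΦ e b).hausdorffMeasure_side hr (μ.radius_mem_Ioo _) (hΦ e),
    ENNReal.toReal_ofReal (mul_nonneg (sin_pos_of_mem_Ioo hr).le
      (mul_pos two_pos (halfAngle_mem_Ioo _ _ _).1).le)]

theorem totalGeodesicCurvature_eq [Fintype E] (hΦ : ∀ e, Φ e ∈ Ioo 0 π)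
    (μ : SphericalConicalMetric D Φ) :
    μ.totalGeodesicCurvature = curvatureMap D.toFlagGluing Φ μ.geodesicCurvature := by
  classical
  funext f
  refine Finset.sum_congr rfl fun s hs => ?_
  obtain rfl := (Finset.mem_filter.1 hs).2
  have hcot := sin_arccot_mul (μ.geodesicCurvature (D.sideFace s.1 s.2))
  rw [arccot_geodesicCurvature] at hcot
  rw [μ.sideLength_eq hΦ, sideCurvature, arccot_geodesicCurvature, ← hcot]
  simp only [geodesicCurvature, sideRadius]
  ring

theorem exists_congruence (hΦ : ∀ e, Φ e ∈ Ioo 0 π) {μ ν : SphericalConicalMetric D Φ}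
    (h : μ.radius = ν.radius) (e : E) : ∃ R : E3 ≃ₗᵢ[ℝ] E3,
      (∀ b, R (μ.center e b) = ν.center e b) ∧ ∀ b, R (μ.corner e b) = ν.corner e b := by
  have hν := ν.isLens hΦ e false
  simp only [sideRadius, ← h] at hν
  obtain ⟨R, hc, hc', hp, hq⟩ := (μ.isLens hΦ e false).exists_congruence hν
    (μ.radius_mem_Ioo _) (μ.radius_mem_Ioo _) (hΦ e)
  exact ⟨R, Bool.forall_bool.2 ⟨hc, hc'⟩, Bool.forall_bool.2 ⟨hp, hq⟩⟩

theorem isometric_of_radius_eq (hΦ : ∀ e, Φ e ∈ Ioo 0 π) {μ ν : SphericalConicalMetric D Φ}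
    (h : μ.radius = ν.radius) : μ.Isometric ν := by
  choose R hcenter hcorner using exists_congruence hΦ h
  have hside (e b) : ν.sideRadius e b = μ.sideRadius e b := by rw [sideRadius, sideRadius, h]
  have hedge (e) : ν.edgePoint e = R e (μ.edgePoint e) := by
    simp only [edgePoint, ← hcenter, hside, map_smul, map_add, angle_map]
  have hchart (x p) : ν.chart x p = R x.1 (μ.chart x p) := by
    simp only [chart, ← hcenter, ← hcorner, hedge, ← map_smul, ← map_add,
      LinearIsometryEquiv.norm_map]
  have hstep : ν.stepDist = μ.stepDist := by
    funext x y
    simp only [stepDist, hchart, angle_map]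
  have hdisk : ν.disk = μ.disk := by
    funext f
    simp only [disk, sphDisk, hchart, ← hcenter, mem_ofPred_eq, LinearIsometryEquiv.norm_map,
      angle_map, h]
  refine ⟨.refl S, fun x y => ?_, fun f => ?_, ⟨⟨Prod.snd, continuous_snd⟩, fun _ => rfl,
    fun _ => rfl, fun _ => IsHomeomorph.id⟩⟩
  · simp only [gluedDist, hstep, Homeomorph.refl_apply, id]
  · rw [hdisk]
    exact image_id _

/-- The metric with given radii whose quadrilaterals are all in polar position. -/
def ofRadius (D : CellularDecomposition S E F) (hΦ : ∀ e, Φ e ∈ Ioo 0 π) (r : F → ℝ)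
    (hr : ∀ f, r f ∈ Ioc 0 (π / 2)) : SphericalConicalMetric D Φ :=
  have hrπ (f) : r f ∈ Ioo 0 π := ⟨(hr f).1, (hr f).2.trans_lt (half_lt_self pi_pos)⟩
  have hlens (e) := isLens_polar (hrπ (D.sideFace e false)) (hrπ (D.sideFace e true)) (hΦ e)
  { radius := r
    radius_mem := hr
    center := fun e b => polar (if b then
      centerDist (r (D.sideFace e false)) (r (D.sideFace e true)) (Φ e) else 0) 0
    corner := fun e h => polar (r (D.sideFace e false)) (if h then
      -halfAngle (Φ e) (cot (r (D.sideFace e false))) (cot (r (D.sideFace e true))) else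
      halfAngle (Φ e) (cot (r (D.sideFace e false))) (cot (r (D.sideFace e true))))
    norm_center := fun _ _ => norm_polar _ _
    corner_mem := fun e b h => (mem_sphCircle_iff (norm_polar _ _)
      (Ioo_subset_Icc_self (hrπ _))).2 ⟨norm_polar _ _, match b, h with
        | false, false => (hlens e).inner_left
        | false, true => (hlens e).inner_left'
        | true, false => (hlens e).inner_right
        | true, true => (hlens e).inner_right'⟩
    corner_ne := fun e => (hlens e).corner_ne
    angle_corner := fun e h => match h with
      | false => (pi_sub_sphAngle_eq_iff (norm_polar _ _) (norm_polar _ _) (norm_polar _ _)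
          (hrπ _) (hrπ _) (Ioo_subset_Icc_self (hΦ e)) (hlens e).inner_left
          (hlens e).inner_right).2 (hlens e).inner_centers
      | true => (pi_sub_sphAngle_eq_iff (norm_polar _ _) (norm_polar _ _) (norm_polar _ _)
          (hrπ _) (hrπ _) (Ioo_subset_Icc_self (hΦ e)) (hlens e).inner_left'
          (hlens e).inner_right').2 (hlens e).inner_centers }

theorem exists_geodesicCurvature_eq (D : CellularDecomposition S E F) (hΦ : ∀ e, Φ e ∈ Ioo 0 π)
    {k : F → ℝ} (hk : 0 ≤ k) : ∃ μ : SphericalConicalMetric D Φ, μ.geodesicCurvature = k :=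
  ⟨ofRadius D hΦ (fun f => arccot (k f)) fun f => ⟨(arccot_mem_Ioo _).1,
    sub_le_self _ (arctan_nonneg.2 (hk f))⟩, funext fun f => cot_arccot (k f)⟩

end SphericalConicalMetric

end CirclePattern

end

theorem theorem1p6_general {S E F : Type*} [TopologicalSpace S] [Fintype E] [Fintype F]
    (D : CellularDecomposition S E F) (Φ : E → ℝ) (hΦ : ∀ e, Φ e ∈ Set.Ioo 0 Real.pi) :
    (∀ L : F → ℝ, (∃ μ : SphericalConicalMetric D Φ, μ.totalGeodesicCurvature = L) ↔
      L ∈ LSet D.toFlagGluing Φ) ∧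
    (∀ μ ν : SphericalConicalMetric D Φ,
      μ.totalGeodesicCurvature = ν.totalGeodesicCurvature → μ.Isometric ν) ∧
    (∀ k : F → ℝ, (∀ f, 0 ≤ k f) →
      ∃ μ : SphericalConicalMetric D Φ, μ.geodesicCurvature = k) ∧
    (∀ μ ν : SphericalConicalMetric D Φ,
      μ.geodesicCurvature = ν.geodesicCurvature → μ.Isometric ν) ∧
    ∃ curv : {k : F → ℝ // ∀ f, 0 ≤ k f} ≃ₜ LSet D.toFlagGluing Φ,
      (∀ (μ : SphericalConicalMetric D Φ) (k : {k : F → ℝ // ∀ f, 0 ≤ k f}),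
        μ.geodesicCurvature = k.1 → μ.totalGeodesicCurvature = (curv k).1) ∧
      (∀ k, (∀ f, 0 < k.1 f) ↔ (curv k).1 ∈ L₁ D.toFlagGluing Φ) ∧
      (∀ k, k.1 ∈ orthantBoundary ↔ (curv k).1 ∈ LBoundary D.toFlagGluing Φ) ∧
      (∀ (I : Finset F) k, k.1 ∈ orthantStratum I ↔
        (curv k).1 ∈ LStratum D.toFlagGluing Φ I) := by
  have hiso (μ ν : SphericalConicalMetric D Φ) (h : μ.geodesicCurvature = ν.geodesicCurvature) :
      μ.Isometric ν :=
    SphericalConicalMetric.isometric_of_radius_eq hΦ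
      (SphericalConicalMetric.radius_eq_of_geodesicCurvature_eq h)
  have htotal (μ : SphericalConicalMetric D Φ) := μ.totalGeodesicCurvature_eq hΦ
  have hbij := bijOn_curvatureMap D.toFlagGluing hΦ
  refine ⟨fun L => ⟨?_, fun hL => ?_⟩, fun μ ν h => hiso μ ν ?_,
    fun k hk => SphericalConicalMetric.exists_geodesicCurvature_eq D hΦ hk, hiso,
    curvatureHomeomorph D.toFlagGluing hΦ, fun μ k h => ?_,
    fun k => (curvatureMap_mem_L₁_iff D.toFlagGluing hΦ k.2).symm,
    fun k => (curvatureMap_mem_LBoundary_iff D.toFlagGluing hΦ k.2).symm,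
    fun I k => (curvatureMap_mem_LStratum_iff D.toFlagGluing hΦ k.2 I).symm⟩
  · rintro ⟨μ, rfl⟩
    exact htotal μ ▸ hbij.mapsTo μ.geodesicCurvature_nonneg
  · obtain ⟨k, hk, rfl⟩ := hbij.surjOn hL
    obtain ⟨μ, rfl⟩ := SphericalConicalMetric.exists_geodesicCurvature_eq D hΦ hk
    exact ⟨μ, htotal μ⟩
  · rw [htotal, htotal] at h
    exact hbij.injOn μ.geodesicCurvature_nonneg ν.geodesicCurvature_nonneg h
  · rw [htotal, h, coe_curvatureHomeomorph]

theorem theorem1p6 {S E F : Type*} [TopologicalSpace S] [T2Space S] [CompactSpace S]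
    [ChartedSpace (EuclideanSpace ℝ (Fin 2)) S] [Fintype E] [Fintype F]
    (D : CellularDecomposition S E F) (Φ : E → ℝ) (hΦ : ∀ e, Φ e ∈ Set.Ioo 0 (Real.pi / 2)) :
    -- existence
    (∀ L : F → ℝ, (∃ μ : SphericalConicalMetric D Φ, μ.totalGeodesicCurvature = L) ↔
      L ∈ LSet D.toFlagGluing Φ) ∧
    -- uniqueness
    (∀ μ ν : SphericalConicalMetric D Φ,
      μ.totalGeodesicCurvature = ν.totalGeodesicCurvature → μ.Isometric ν) ∧
    -- every `k ≥ 0` is the vector of geodesic curvatures of a metric, unique up to isometry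
    (∀ k : F → ℝ, (∀ f, 0 ≤ k f) →
      ∃ μ : SphericalConicalMetric D Φ, μ.geodesicCurvature = k) ∧
    (∀ μ ν : SphericalConicalMetric D Φ,
      μ.geodesicCurvature = ν.geodesicCurvature → μ.Isometric ν) ∧
    -- the curvature map is a homeomorphism that respects interior and boundary strata
    ∃ curv : {k : F → ℝ // ∀ f, 0 ≤ k f} ≃ₜ LSet D.toFlagGluing Φ,
      (∀ (μ : SphericalConicalMetric D Φ) (k : {k : F → ℝ // ∀ f, 0 ≤ k f}),
        μ.geodesicCurvature = k.1 → μ.totalGeodesicCurvature = (curv k).1) ∧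
      (∀ k, (∀ f, 0 < k.1 f) ↔ (curv k).1 ∈ L₁ D.toFlagGluing Φ) ∧
      (∀ k, k.1 ∈ orthantBoundary ↔ (curv k).1 ∈ LBoundary D.toFlagGluing Φ) ∧
      (∀ (I : Finset F) k, k.1 ∈ orthantStratum I ↔
        (curv k).1 ∈ LStratum D.toFlagGluing Φ I) :=
  theorem1p6_general D Φ fun e => ⟨(hΦ e).1, (hΦ e).2.trans (half_lt_self Real.pi_pos)⟩
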